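/- Let $F=\{0,\dots,n-1\}$ be a finite set of binary features, let an example over $F$ be a map $e:F\to\{0,1\}$, and let a partial example be a map $\tau:F'\to\{0,1\}$ with $F'\subseteq F$. A decision tree $T$ over $F$ is a rooted binary tree in which every inner node is labelled by a feature and has a $0$-child and a $1$-child, and every leaf is labelled by a class in $\{0,1\}$; $T(e)$ is the label of the leaf reached from the root by going, at a node labelled $f$, to its $e(f)$-child. For an example $e$ and a class $c\in\{0,1\}$: * a local abductive explanation (lAXp) for $e$ is a set $A\subseteq F$ such that $T(e')=T(e)$ for every example $e'$ that agrees with $e$ on $A$; * a local contrastive explanation (lCXp) for $e$ is a set $A\subseteq F$ such that some example $e'$ with $T(e')\neq T(e)$ differs from $e$ only on features in $A$; * a global abductive explanation (gAXp) for $c$ is a partial example $\tau$ such that $T(e')=c$ for every example $e'$ that agrees with $\tau$; * a global contrastive explanation (gCXp) for $c$ is a partial example $\tau$ such that $T(e')\neq c$ for every example $e'$ that agrees with $\tau$. **Theorem.** Each of the following four search problems can be solved in polynomial time, that is, by a deterministic (multi-stack) Turing machine whose running time is bounded by a polynomial in the length of the input. 1. Given a decision tree $T$ and an example $e$, find an inclusion-wise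 minimal lAXp for $e$ with respect to $T$. 2. Given a decision tree $T$ and an example $e$, find an inclusion-wise minimal lCXp for $e$ with respect to $T$. 3. Given a decision tree $T$ and a class $c$, find an inclusion-wise minimal gAXp for $c$ with respect to $T$. 4. Given a decision tree $T$ and a class $c$, find an inclusion-wise minimal gCXp for $c$ with respect to $T$. In each problem the algorithm reports that there is no explanation precisely when none exists. Minimality of a partial example means that no restriction of it to a proper subset of its domain is an explanation. Features are written in binary, trees in prefix order, and examples and solutions as lists. -/

import Mathlib

namespace DTExplain

/-! ### Examples, models, explanations -/

/-- An example over a set `F` of binary features: a `{0,1}`-assignment (`false` is 0, `true` is 1). -/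
abbrev Example (F : Type) : Type := F → Bool

/-- A binary classification model, seen as the Boolean function that it represents. -/
abbrev Model (F : Type) : Type := Example F → Bool

/-- A partial example: an assignment of a subset of the features; `none` means undefined. -/
abbrev PartialExample (F : Type) : Type := F → Option Bool

/-- The example `e` agrees with the partial example `τ`. -/
def Agrees {F : Type} (e : Example F) (τ : PartialExample F) : Prop :=
  ∀ f b, τ f = some b → e f = b

/-- `τ' ⊆ τ`: the partial example `τ'` is a restriction of `τ` to a subset of its domain. -/
def Restricts {F : Type} (τ' τ : PartialExample F) : Prop :=
  ∀ f b, τ' f = some b → τ f = some b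

/-- `A` is a local abductive explanation for `e` with respect to `M`. -/
def IsLocalAXp {F : Type} (M : Model F) (e : Example F) (A : Finset F) : Prop :=
  ∀ e' : Example F, (∀ f ∈ A, e' f = e f) → M e = M e'

/-- `A` is a local contrastive explanation for `e` with respect to `M`. -/
def IsLocalCXp {F : Type} (M : Model F) (e : Example F) (A : Finset F) : Prop :=
  ∃ e' : Example F, M e' ≠ M e ∧ ∀ f, f ∉ A → e' f = e f

/-- `τ` is a global abductive explanation for the class `c` with respect to `M`. -/
def IsGlobalAXp {F : Type} (M : Model F) (c : Bool) (τ : PartialExample F) : Prop :=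
  ∀ e : Example F, Agrees e τ → M e = c

/-- `τ` is a global contrastive explanation for the class `c` with respect to `M`. -/
def IsGlobalCXp {F : Type} (M : Model F) (c : Bool) (τ : PartialExample F) : Prop :=
  ∀ e : Example F, Agrees e τ → M e ≠ c

/-- `A` is an inclusion-wise minimal set of features with the property `P`. -/
def SubsetMinimal {F : Type} (P : Finset F → Prop) (A : Finset F) : Prop :=
  P A ∧ ∀ A' : Finset F, A' ⊆ A → P A' → A' = A

/-- `τ` is an inclusion-wise minimal partial example with the property `P`. -/
def RestrictionMinimal {F : Type} (P : PartialExample F → Prop) (τ : PartialExample F) : Prop :=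
  P τ ∧ ∀ τ' : PartialExample F, Restricts τ' τ → P τ' → τ' = τ

/-! ### Decision trees -/

/-- Decision trees: inner nodes carry a feature, a `0`-child and a `1`-child (in this order),
leaves carry a class. A feature may occur repeatedly on a path. -/
inductive DecisionTree (F : Type) : Type
  | leaf (c : Bool) : DecisionTree F
  | node (f : F) (child0 child1 : DecisionTree F) : DecisionTree F

/-- The classification function of a decision tree. -/
def DecisionTree.classify {F : Type} : DecisionTree F → Model F
  | .leaf c, _ => c
  | .node f child0 child1, e => if e f then child1.classify e else child0.classify e

/-! ### Instances and their encodings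

The features are numbered: the feature set of an instance is `Fin n`. -/

/-- A decision tree together with an example. -/
structure LocalInstance : Type where
  n : ℕ
  tree : DecisionTree (Fin n)
  ex : Example (Fin n)

/-- A decision tree together with a class. -/
structure GlobalInstance : Type where
  n : ℕ
  tree : DecisionTree (Fin n)
  c : Bool

/-- The finite alphabet in which instances and solutions are written. -/
inductive Symbol : Type
  | bit (b : Bool)
  | sep
  | node
  | leaf (c : Bool)
  | val (b : Bool)
  | noExplanation
  deriving DecidableEq, Fintype

/-- A number in binary, followed by a separator. -/
def encodeNumber (i : ℕ) : List Symbol :=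
  (Computability.encodeNat i).map Symbol.bit ++ [Symbol.sep]

/-- A decision tree in prefix order. -/
def encodeTree {n : ℕ} : DecisionTree (Fin n) → List Symbol
  | .leaf c => [Symbol.leaf c]
  | .node f child0 child1 =>
      Symbol.node :: (encodeNumber f ++ encodeTree child0 ++ encodeTree child1)

/-- A list of features. -/
def encodeFeatures {n : ℕ} (l : List (Fin n)) : List Symbol :=
  l.flatMap fun f => encodeNumber f

/-- A list of assignments `f = b`. -/
def encodeAssignments {n : ℕ} (l : List (Fin n × Bool)) : List Symbol :=
  l.flatMap fun p => encodeNumber p.1 ++ [Symbol.val p.2]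

/-- The number of features, the tree, and the value of the example on every feature. -/
def LocalInstance.encode (i : LocalInstance) : List Symbol :=
  encodeNumber i.n ++ encodeTree i.tree ++
    encodeAssignments ((List.finRange i.n).map fun f => (f, i.ex f))

/-- The number of features, the tree, and the class. -/
def GlobalInstance.encode (i : GlobalInstance) : List Symbol :=
  encodeNumber i.n ++ encodeTree i.tree ++ [Symbol.val i.c]

/-- The word `w` lists the elements of `A`, each once, in some order. -/
def WritesSet {n : ℕ} (w : List Symbol) (A : Finset (Fin n)) : Prop :=
  ∃ l : List (Fin n), l.Nodup ∧ (∀ f, f ∈ l ↔ f ∈ A) ∧ w = encodeFeatures l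

/-- The word `w` lists the assignments made by `τ`, each once, in some order. -/
def WritesPartialExample {n : ℕ} (w : List Symbol) (τ : PartialExample (Fin n)) : Prop :=
  ∃ l : List (Fin n × Bool), l.Nodup ∧ (∀ f b, (f, b) ∈ l ↔ τ f = some b) ∧
    w = encodeAssignments l

/-! ### Search problems and polynomial time -/

/-- A search problem: instances written as words, and, for each instance, the objects that are
searched for, the words that write them, and the solutions among them. -/
structure SearchProblem : Type 1 where
  Instance : Type
  encode : Instance → List Symbol
  Candidate : Instance → Type
  Writes : (i : Instance) → List Symbol → Candidate i → Prop
  IsSolution : (i : Instance) → Candidate i → Prop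

/-- The search problem is solved in polynomial time by a (multi-stack) Turing machine: on each
instance it outputs a solution if there is one, and reports correctly if there is none. -/
def SearchProblem.SolvableInPolyTime (P : SearchProblem) : Prop :=
  ∃ f : P.Instance → List Symbol,
    Nonempty (Turing.TM2ComputableInPolyTime P.encode id f) ∧
    ∀ i : P.Instance,
      (∃ s : P.Candidate i, P.IsSolution i s ∧ P.Writes i (f i) s) ∨
      ((∀ s : P.Candidate i, ¬ P.IsSolution i s) ∧ f i = [Symbol.noExplanation])

/-- Find a subset-minimal local abductive explanation for an example w.r.t. a decision tree. -/
def dtLocalAXpSubsetMinimal : SearchProblem where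
  Instance := LocalInstance
  encode := LocalInstance.encode
  Candidate i := Finset (Fin i.n)
  Writes _ := WritesSet
  IsSolution i := SubsetMinimal (IsLocalAXp i.tree.classify i.ex)

/-- Find a subset-minimal local contrastive explanation for an example w.r.t. a decision tree. -/
def dtLocalCXpSubsetMinimal : SearchProblem where
  Instance := LocalInstance
  encode := LocalInstance.encode
  Candidate i := Finset (Fin i.n)
  Writes _ := WritesSet
  IsSolution i := SubsetMinimal (IsLocalCXp i.tree.classify i.ex)

/-- Find a subset-minimal global abductive explanation for a class w.r.t. a decision tree. -/
def dtGlobalAXpSubsetMinimal : SearchProblem where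
  Instance := GlobalInstance
  encode := GlobalInstance.encode
  Candidate i := PartialExample (Fin i.n)
  Writes _ := WritesPartialExample
  IsSolution i := RestrictionMinimal (IsGlobalAXp i.tree.classify i.c)

/-- Find a subset-minimal global contrastive explanation for a class w.r.t. a decision tree. -/
def dtGlobalCXpSubsetMinimal : SearchProblem where
  Instance := GlobalInstance
  encode := GlobalInstance.encode
  Candidate i := PartialExample (Fin i.n)
  Writes _ := WritesPartialExample
  IsSolution i := RestrictionMinimal (IsGlobalCXp i.tree.classify i.c)

end DTExplain

/-! The combinatorial core is one query: does some example that satisfies a list `τ` of assignments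
have class `b`? A decision tree has only linearly many root-to-leaf paths, and an example has class
`b` exactly when it satisfies the path to some leaf of class `b`. So the answer is yes iff for one
such path the union with `τ` assigns no feature both values (`sat_iff`).

All four notions of explanation are expressed by this query and are monotone: adding features or
assignments to an explanation keeps it one. Hence a single greedy pass that tries to delete each
assignment once ends in a minimal explanation (`greedy_spec`, `subsetMinimal_of_remove`,
`restrictionMinimal_partialExample`). It remains to find a start. For an lAXp it is the whole
example. For an lCXp it is the set of all features, provided that some example has the other class.
For a gAXp it is a consistent path to a leaf of class `c`, which exists iff a gAXp exists
(`globalWord_spec`). A gCXp for `c` is a gAXp for the other class.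

For the running time, structured programs on four stacks are given a timed semantics and compiled to
Turing machines (`Exec.simulate`). Values are binary trees, written in prefix order on one stack.
Polynomial-time functions on them are closed under composition, pairing, case distinction, and folds
whose intermediate values stay polynomially bounded (`Poly.foldl`); the algorithms are assembled
from these closure properties. Conversion between words and trees is linear
(`Poly.tm2ComputableInPolyTime`).

The machine never turns a feature into a number: it works with the binary words themselves. The
algorithms only compare features for equality, so they commute with injective renamings
(`localAXp_map`, `localCXp_map`, `globalAXp_map`), and correctness may be proved over `Fin n`. -/

open Function (update)

namespace StackProgram

open DTExplain (Symbol)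

/-! ### Structured programs on four stacks -/

/-- The stacks of the machine. -/
inductive Stack : Type
  | d | a | b | c
  deriving DecidableEq

instance Stack.fintype : Fintype Stack :=
  ⟨{.d, .a, .b, .c}, fun k => by cases k <;> decide⟩

/-- Structured programs. The register holds the result of the last `pop`. -/
inductive Cmd : Type
  | push (k : Stack) (f : Option Symbol → Symbol)
  | pop (k : Stack)
  | seq (c₁ c₂ : Cmd)
  | ite (p : Option Symbol → Bool) (c₁ c₂ : Cmd)
  | loop (p : Option Symbol → Bool) (c : Cmd)

/-- The register and the stacks. -/
structure State : Type where
  reg : Option Symbol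
  stk : Stack → List Symbol

/-- `Exec c s s' t`: the program `c` leads from `s` to `s'` within `t` steps. -/
inductive Exec : Cmd → State → State → ℕ → Prop
  | push (k f s) : Exec (.push k f) s ⟨s.reg, update s.stk k (f s.reg :: s.stk k)⟩ 1
  | pop (k s) : Exec (.pop k) s ⟨(s.stk k).head?, update s.stk k (s.stk k).tail⟩ 1
  | seq {c₁ c₂ s s' s'' t t'} : Exec c₁ s s' t → Exec c₂ s' s'' t' →
      Exec (.seq c₁ c₂) s s'' (t + t')
  | ite_true {p c₁ c₂ s s' t} : p s.reg = true → Exec c₁ s s' t →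
      Exec (.ite p c₁ c₂) s s' (t + 1)
  | ite_false {p c₁ c₂ s s' t} : p s.reg = false → Exec c₂ s s' t →
      Exec (.ite p c₁ c₂) s s' (t + 1)
  | loop_true {p c s s' s'' t t'} : p s.reg = true → Exec c s s' t →
      Exec (.loop p c) s' s'' t' → Exec (.loop p c) s s'' (t + t' + 1)
  | loop_false {p c s} : p s.reg = false → Exec (.loop p c) s s 1
  | weaken {c s s' t t'} : Exec c s s' t → t ≤ t' → Exec c s s' t'

/-! ### Compilation to Turing machines -/

/-- The program points of a program. -/
def Cmd.Point : Cmd → Type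
  | .push _ _ => Unit
  | .pop _ => Unit
  | .seq c₁ c₂ => c₁.Point ⊕ c₂.Point
  | .ite _ c₁ c₂ => Option (c₁.Point ⊕ c₂.Point)
  | .loop _ c => Option c.Point

instance Cmd.fintypePoint : (c : Cmd) → Fintype c.Point
  | .push _ _ => inferInstanceAs (Fintype Unit)
  | .pop _ => inferInstanceAs (Fintype Unit)
  | .seq c₁ c₂ =>
      letI := fintypePoint c₁
      letI := fintypePoint c₂
      inferInstanceAs (Fintype (c₁.Point ⊕ c₂.Point))
  | .ite _ c₁ c₂ =>
      letI := fintypePoint c₁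
      letI := fintypePoint c₂
      inferInstanceAs (Fintype (Option (c₁.Point ⊕ c₂.Point)))
  | .loop _ c =>
      letI := fintypePoint c
      inferInstanceAs (Fintype (Option c.Point))

/-- The program point at which a program starts. -/
def Cmd.entry : (c : Cmd) → c.Point
  | .push _ _ => ()
  | .pop _ => ()
  | .seq c₁ _ => Sum.inl c₁.entry
  | .ite _ _ _ => none
  | .loop _ _ => none

/-- Statements of the machines that programs are compiled to. -/
abbrev MStmt (Λ : Type) : Type := Turing.TM2.Stmt (fun _ : Stack => Symbol) Λ (Option Symbol)

/-- The statement at each program point, for an embedding `emb` of the program points into the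
labels and a label `next` at which the execution continues. -/
def Cmd.code {Λ : Type} : (c : Cmd) → (emb : c.Point → Λ) → (next : Λ) → c.Point → MStmt Λ
  | .push k f, _, next, _ => .push k f (.goto fun _ => next)
  | .pop k, _, next, _ => .pop k (fun _ o => o) (.goto fun _ => next)
  | .seq c₁ c₂, emb, _, .inl q =>
      c₁.code (fun q => emb (Sum.inl q)) (emb (Sum.inr c₂.entry)) q
  | .seq _ c₂, emb, next, .inr q => c₂.code (fun q => emb (Sum.inr q)) next q
  | .ite p c₁ c₂, emb, _, none =>
      .branch p (.goto fun _ => emb (some (Sum.inl c₁.entry)))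
        (.goto fun _ => emb (some (Sum.inr c₂.entry)))
  | .ite _ c₁ _, emb, next, some (Sum.inl q) =>
      c₁.code (fun q => emb (some (Sum.inl q))) next q
  | .ite _ _ c₂, emb, next, some (Sum.inr q) =>
      c₂.code (fun q => emb (some (Sum.inr q))) next q
  | .loop p c, emb, next, none =>
      .branch p (.goto fun _ => emb (some c.entry)) (.goto fun _ => next)
  | .loop _ c, emb, _, some q => c.code (fun q => emb (some q)) (emb none) q

/-- The configuration of the machine at a label. -/
def State.at {Λ : Type} (s : State) (l : Option Λ) :
    Turing.TM2.Cfg (fun _ : Stack => Symbol) Λ (Option Symbol) := ⟨l, s.reg, s.stk⟩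

/-- Induction on the execution, for every continuation label: the first part of a sequence continues
at the entry of the second, and a loop body continues at the loop test. Of `emb` nothing is needed
but that `M` carries the compiled code at the embedded points. -/
theorem Exec.simulate {Λ : Type} (M : Λ → MStmt Λ) {c : Cmd} {s s' : State} {t : ℕ}
    (h : Exec c s s' t) (emb : c.Point → Λ) (next : Λ)
    (hM : ∀ q, M (emb q) = c.code emb next q) :
    ∃ t' ≤ t, (flip bind (Turing.TM2.step M))^[t'] (some (s.at (some (emb c.entry)))) =
      some (s'.at (some next)) := by
  induction h generalizing next with
  | push k f s =>
    refine ⟨1, le_rfl, ?_⟩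
    simp [flip, State.at, Turing.TM2.step, hM, Cmd.code]
  | pop k s =>
    refine ⟨1, le_rfl, ?_⟩
    simp [flip, State.at, Turing.TM2.step, hM, Cmd.code]
  | @seq c₁ c₂ s s' s'' t t' h₁ h₂ ih₁ ih₂ =>
    obtain ⟨u₁, hu₁, e₁⟩ := ih₁ (fun q => emb (Sum.inl q)) (emb (Sum.inr c₂.entry))
      (fun q => hM (Sum.inl q))
    obtain ⟨u₂, hu₂, e₂⟩ := ih₂ (fun q => emb (Sum.inr q)) next (fun q => hM (Sum.inr q))
    refine ⟨u₂ + u₁, by omega, ?_⟩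
    rw [Function.iterate_add_apply]
    exact (congrArg _ e₁).trans e₂
  | @ite_true p c₁ c₂ s s' t hp h ih =>
    obtain ⟨u, hu, e⟩ := ih (fun q => emb (some (Sum.inl q))) next
      (fun q => hM (some (Sum.inl q)))
    refine ⟨u + 1, by omega, ?_⟩
    rw [Function.iterate_succ_apply]
    refine Eq.trans (congrArg _ ?_) e
    have h₀ : M (emb none) = _ := hM none
    simp [flip, State.at, Turing.TM2.step, Cmd.entry, h₀, Cmd.code, hp]
  | @ite_false p c₁ c₂ s s' t hp h ih =>
    obtain ⟨u, hu, e⟩ := ih (fun q => emb (some (Sum.inr q))) next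
      (fun q => hM (some (Sum.inr q)))
    refine ⟨u + 1, by omega, ?_⟩
    rw [Function.iterate_succ_apply]
    refine Eq.trans (congrArg _ ?_) e
    have h₀ : M (emb none) = _ := hM none
    simp [flip, State.at, Turing.TM2.step, Cmd.entry, h₀, Cmd.code, hp]
  | @loop_true p c s s' s'' t t' hp h h' ih ih' =>
    obtain ⟨u, hu, e⟩ := ih (fun q => emb (some q)) (emb none) (fun q => hM (some q))
    obtain ⟨u', hu', e'⟩ := ih' emb next hM
    refine ⟨u' + u + 1, by omega, ?_⟩
    rw [Function.iterate_succ_apply, Function.iterate_add_apply]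
    refine Eq.trans (congrArg _ (Eq.trans (congrArg _ ?_) e)) e'
    have h₀ : M (emb none) = _ := hM none
    simp [flip, State.at, Turing.TM2.step, Cmd.entry, h₀, Cmd.code, hp]
  | @loop_false p c s hp =>
    refine ⟨1, le_rfl, ?_⟩
    have h₀ : M (emb none) = _ := hM none
    simp [flip, State.at, Turing.TM2.step, Cmd.entry, h₀, Cmd.code, hp]
  | weaken _ htt' ih =>
    obtain ⟨u, hu, e⟩ := ih emb next hM
    exact ⟨u, hu.trans htt', e⟩

/-- The machine that runs a program on the stack `d` and then halts. -/
def Cmd.machine (c : Cmd) : Turing.FinTM2 where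
  K := Stack
  k₀ := .d
  k₁ := .d
  Γ _ := Symbol
  Λ := Option c.Point
  main := some c.entry
  σ := Option Symbol
  initialState := none
  m
    | none => .halt
    | some q => c.code some none q

/-- The contents of the stacks. -/
def stackContents (d a b c : List Symbol) : Stack → List Symbol
  | .d => d
  | .a => a
  | .b => b
  | .c => c

/-- The additional step executes `halt`. A halting configuration in Mathlib's sense has the initial
register and all stacks but the output empty, hence the strict form of the final state. -/
theorem Exec.outputs {c : Cmd} {w w' : List Symbol} {t : ℕ}
    (h : Exec c ⟨none, stackContents w [] [] []⟩ ⟨none, stackContents w' [] [] []⟩ t) :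
    Nonempty (Turing.TM2OutputsInTime c.machine w (some w') (t + 1)) := by
  obtain ⟨u, hu, e⟩ := h.simulate c.machine.m some none (fun q => rfl)
  have h₁ : (some (Turing.initList c.machine w) : Option c.machine.Cfg) =
      some (State.at ⟨none, stackContents w [] [] []⟩ (some (some c.entry))) := by
    refine congrArg some ?_
    simp only [Turing.initList, State.at]
    congr 1
    funext k
    cases k <;> rfl
  have h₂ : (Turing.haltList c.machine w' : c.machine.Cfg) =
      State.at ⟨none, stackContents w' [] [] []⟩ none := by
    simp only [Turing.haltList, State.at]
    congr 1
    funext k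
    cases k <;> rfl
  have h₃ : (flip bind c.machine.step)^[1 + u] (some (Turing.initList c.machine w)) =
      some (Turing.haltList c.machine w') := by
    rw [Function.iterate_add_apply]
    exact (congrArg _ ((congrArg _ h₁).trans e)).trans (congrArg some h₂.symm)
  exact ⟨⟨⟨1 + u, h₃⟩, by show 1 + u ≤ t + 1; omega⟩⟩

/-! ### Steps on explicit stack contents -/

/-- The state with given register and stacks. -/
def st (r : Option Symbol) (d a b c : List Symbol) : State := ⟨r, stackContents d a b c⟩

theorem Exec.of_eq {c : Cmd} {s s' s'' : State} {t : ℕ} (h : Exec c s s' t) (e : s' = s'') :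
    Exec c s s'' t := e ▸ h

theorem State.ext_st {s : State} {r d a b c} (hr : s.reg = r) (hd : s.stk .d = d)
    (ha : s.stk .a = a) (hb : s.stk .b = b) (hc : s.stk .c = c) : s = st r d a b c := by
  obtain ⟨_, S⟩ := s
  simp only at hr hd ha hb hc
  subst hr hd ha hb hc
  simp only [st, State.mk.injEq, true_and]
  funext k
  cases k <;> rfl

section Steps

variable (f : Option Symbol → Symbol) (r : Option Symbol) (d a b c : List Symbol)

theorem Exec.push_d : Exec (.push .d f) (st r d a b c) (st r (f r :: d) a b c) 1 :=
  Exec.of_eq (Exec.push _ _ _) (State.ext_st rfl rfl rfl rfl rfl)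

theorem Exec.push_a : Exec (.push .a f) (st r d a b c) (st r d (f r :: a) b c) 1 :=
  Exec.of_eq (Exec.push _ _ _) (State.ext_st rfl rfl rfl rfl rfl)

theorem Exec.push_b : Exec (.push .b f) (st r d a b c) (st r d a (f r :: b) c) 1 :=
  Exec.of_eq (Exec.push _ _ _) (State.ext_st rfl rfl rfl rfl rfl)

theorem Exec.push_c : Exec (.push .c f) (st r d a b c) (st r d a b (f r :: c)) 1 :=
  Exec.of_eq (Exec.push _ _ _) (State.ext_st rfl rfl rfl rfl rfl)

theorem Exec.pop_d : Exec (.pop .d) (st r d a b c) (st d.head? d.tail a b c) 1 :=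
  Exec.of_eq (Exec.pop _ _) (State.ext_st rfl rfl rfl rfl rfl)

theorem Exec.pop_a : Exec (.pop .a) (st r d a b c) (st a.head? d a.tail b c) 1 :=
  Exec.of_eq (Exec.pop _ _) (State.ext_st rfl rfl rfl rfl rfl)

theorem Exec.pop_c : Exec (.pop .c) (st r d a b c) (st c.head? d a b c.tail) 1 :=
  Exec.of_eq (Exec.pop _ _) (State.ext_st rfl rfl rfl rfl rfl)

end Steps

/-- The symbol in the register. -/
def regSymbol (r : Option Symbol) : Symbol := r.getD .sep

/-- Move the stack `k` onto the stack `k'`, which reverses it. -/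
def pour (k k' : Stack) : Cmd :=
  .seq (.pop k) (.loop Option.isSome (.seq (.push k' regSymbol) (.pop k)))

/-- The loop is entered with one symbol already popped into the register, so `r` is pushed before
`l`; an empty register signals that the source is exhausted. -/
theorem exec_pourLoop {k k' : Stack} (hk : k ≠ k') (l : List Symbol) :
    ∀ (r : Symbol) (S : Stack → List Symbol), S k = l →
    Exec (.loop Option.isSome (.seq (.push k' regSymbol) (.pop k))) ⟨some r, S⟩
      ⟨none, update (update S k []) k' (l.reverse ++ r :: S k')⟩ (3 * l.length + 4) := by
  induction l with
  | nil =>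
    intro r S hS
    refine Exec.weaken (Exec.loop_true rfl (.seq (.push _ _ _) (.pop _ _)) ?_)
      (t := 1 + 1 + 1 + 1) (by simp)
    have : update (update S k' (r :: S k')) k [] = update (update S k []) k' (r :: S k') :=
      Function.update_comm hk.symm _ _ _
    simpa [regSymbol, hk, hS, this] using Exec.loop_false (p := Option.isSome)
      (c := .seq (.push k' regSymbol) (.pop k)) (s := ⟨none, update (update S k []) k' (r :: S k')⟩)
      rfl
  | cons x l ih =>
    intro r S hS
    refine Exec.weaken (Exec.loop_true rfl (.seq (.push _ _ _) (.pop _ _)) ?_)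
      (t := 1 + 1 + (3 * l.length + 4) + 1) (by simp; omega)
    refine Exec.of_eq (s' := ⟨none, update (update (update S k l) k' (r :: S k')) k [] |> fun T =>
      update T k' (l.reverse ++ x :: r :: S k')⟩) ?_ ?_
    · have := ih x (update (update S k' (r :: S k')) k l) (by simp)
      rw [Function.update_comm hk]
      simpa [regSymbol, hk, hk.symm, hS] using this
    · simp [Function.update_comm hk.symm]

theorem exec_pour {k k' : Stack} (hk : k ≠ k') (r : Option Symbol) (S : Stack → List Symbol) :
    Exec (pour k k') ⟨r, S⟩ ⟨none, update (update S k []) k' ((S k).reverse ++ S k')⟩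
      (3 * (S k).length + 2) := by
  rcases h : S k with _ | ⟨x, l⟩
  · refine Exec.weaken (Exec.seq (.pop _ _) ?_) (t := 1 + 1) (by simp)
    have : update S k [] = S := by simp [← h]
    simpa [h, this] using Exec.loop_false (p := Option.isSome)
      (c := .seq (.push k' regSymbol) (.pop k)) (s := ⟨none, S⟩) rfl
  · refine Exec.weaken (Exec.seq (.pop _ _) ?_) (t := 1 + (3 * l.length + 4)) (by simp; omega)
    simpa [h, hk.symm] using exec_pourLoop hk l x (update S k l) (by simp)

section Pours

variable (r : Option Symbol) (d a b c : List Symbol)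

theorem exec_pour_ad : Exec (pour .a .d) (st r d a b c) (st none (a.reverse ++ d) [] b c)
    (3 * a.length + 2) :=
  Exec.of_eq (exec_pour (by decide) _ _) (State.ext_st rfl rfl rfl rfl rfl)

theorem exec_pour_da : Exec (pour .d .a) (st r d a b c) (st none [] (d.reverse ++ a) b c)
    (3 * d.length + 2) :=
  Exec.of_eq (exec_pour (by decide) _ _) (State.ext_st rfl rfl rfl rfl rfl)

theorem exec_pour_ab : Exec (pour .a .b) (st r d a b c) (st none d [] (a.reverse ++ b) c)
    (3 * a.length + 2) :=
  Exec.of_eq (exec_pour (by decide) _ _) (State.ext_st rfl rfl rfl rfl rfl)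

theorem exec_pour_ba : Exec (pour .b .a) (st r d a b c) (st none d (b.reverse ++ a) [] c)
    (3 * b.length + 2) :=
  Exec.of_eq (exec_pour (by decide) _ _) (State.ext_st rfl rfl rfl rfl rfl)

theorem exec_pour_bc : Exec (pour .b .c) (st r d a b c) (st none d a [] (b.reverse ++ c))
    (3 * b.length + 2) :=
  Exec.of_eq (exec_pour (by decide) _ _) (State.ext_st rfl rfl rfl rfl rfl)

theorem exec_pour_cd : Exec (pour .c .d) (st r d a b c) (st none (c.reverse ++ d) a b [])
    (3 * c.length + 2) :=
  Exec.of_eq (exec_pour (by decide) _ _) (State.ext_st rfl rfl rfl rfl rfl)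

end Pours

/-! ### Binary trees as data -/

/-- Binary trees with symbols at the leaves. -/
inductive Data : Type
  | atom (s : Symbol)
  | cons (x y : Data)

/-- The word that writes a binary tree. -/
def Data.ser : Data → List Symbol
  | .atom s => [.sep, s]
  | .cons x y => .node :: (x.ser ++ y.ser)

/-- The length of the word that writes a binary tree. -/
def Data.size (x : Data) : ℕ := x.ser.length

@[simp] theorem Data.size_atom (s : Symbol) : (Data.atom s).size = 2 := rfl

@[simp] theorem Data.size_cons (x y : Data) : (Data.cons x y).size = x.size + y.size + 1 := by
  simp [Data.size, Data.ser]

@[simp] theorem Data.length_ser (x : Data) : x.ser.length = x.size := rfl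

/-- The main loop of `scan`. The stack `c` counts the trees still to be read. -/
def scanLoop : Cmd :=
  .loop Option.isSome <| .seq (.pop .d) <| .seq (.push .a regSymbol) <|
    .seq (.ite (fun r => r = some .node)
      (.seq (.push .c fun _ => .node) (.push .c fun _ => .node))
      (.seq (.pop .d) (.push .a regSymbol))) (.pop .c)

/-- A symbol in the register stands for the tree about to be read, and the stack `c` counts in unary
those after it: a node adds two trees, and each pass takes one off. The loop need not stop after
`x`, so the statement prepends the reading of `x` to an arbitrary remaining execution. -/
theorem exec_scanLoop (x : Data) : ∀ (r : Symbol) (d a b c : List Symbol) (s' : State) (t : ℕ),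
    Exec scanLoop (st c.head? d (x.ser.reverse ++ a) b c.tail) s' t →
    Exec scanLoop (st (some r) (x.ser ++ d) a b c) s' (t + 7 * x.size) := by
  induction x with
  | atom s =>
    intro r d a b c s' t h
    exact Exec.weaken (Exec.loop_true rfl (.seq (.pop_d _ _ _ _ _) (.seq (.push_a _ _ _ _ _ _)
      (.seq (.ite_false rfl (.seq (.pop_d _ _ _ _ _) (.push_a _ _ _ _ _ _)))
        (.pop_c _ _ _ _ _)))) h) (by simp; omega)
  | cons x y ihx ihy =>
    intro r d a b c s' t h
    have hy := ihy .node d (x.ser.reverse ++ .node :: a) b c s' t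
      (by simpa [Data.ser] using h)
    have hx := ihx .node (y.ser ++ d) (.node :: a) b (.node :: c) s' _ hy
    have e : (Data.cons x y).ser ++ d = .node :: (x.ser ++ (y.ser ++ d)) := by simp [Data.ser]
    rw [e]
    exact Exec.weaken (Exec.loop_true rfl (.seq (.pop_d _ _ _ _ _) (.seq (.push_a _ _ _ _ _ _)
      (.seq (.ite_true rfl (.seq (.push_c _ _ _ _ _ _) (.push_c _ _ _ _ _ _)))
        (.pop_c _ _ _ _ _)))) hx) (by simp; omega)

/-- Move the tree on top of the stack `d` to the stack `a`. -/
def scan : Cmd := .seq (.push .c fun _ => .node) (.seq (.pop .c) scanLoop)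

theorem exec_scan (x : Data) (r : Option Symbol) (d a b : List Symbol) :
    Exec scan (st r (x.ser ++ d) a b []) (st none d (x.ser.reverse ++ a) b [])
      (7 * x.size + 3) :=
  Exec.weaken (Exec.seq (.push_c _ _ _ _ _ _) (.seq (.pop_c _ _ _ _ _)
    (exec_scanLoop x .node d a b [] _ _ (.loop_false rfl)))) (by omega)

/-- Exchange the two trees on top of the stack `d`. -/
def swap : Cmd :=
  .seq scan <| .seq (pour .a .b) <| .seq scan <| .seq (pour .b .c) <|
    .seq (pour .c .d) (pour .a .d)

theorem exec_swap (x y : Data) (r : Option Symbol) (d : List Symbol) :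
    Exec swap (st r (x.ser ++ (y.ser ++ d)) [] [] []) (st none (y.ser ++ (x.ser ++ d)) [] [] [])
      (16 * (x.size + y.size) + 14) := by
  have h := Exec.seq (exec_scan x r (y.ser ++ d) [] []) <|
    .seq (exec_pour_ab _ _ _ _ _) <| .seq (exec_scan y _ d _ _) <|
    .seq (exec_pour_bc _ _ _ _ _) <| .seq (exec_pour_cd _ _ _ _ _) (exec_pour_ad _ _ _ _ _)
  simp only [List.append_nil, List.reverse_reverse, List.length_reverse, Data.length_ser] at h
  exact h.weaken (by omega)

/-- Empty the stack `a`. -/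
def clear : Cmd := .seq (.pop .a) (.loop Option.isSome (.pop .a))

/-- The alternative `r = none` is excluded because the loop would then stop at once, without
emptying `a`. -/
theorem exec_clearLoop (a : List Symbol) : ∀ (r : Option Symbol) (d b c : List Symbol),
    Exec (.loop Option.isSome (.pop .a)) (st r d a b c) (st none d [] b c) (2 * a.length + 3) ∨
      r = none := by
  induction a with
  | nil =>
    rintro (_ | r) d b c
    · exact .inr rfl
    · exact .inl (Exec.weaken (Exec.loop_true rfl (.pop_a _ _ _ _ _) (.loop_false rfl)) (by simp))
  | cons x a ih =>
    rintro (_ | r) d b c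
    · exact .inr rfl
    · rcases ih (some x) d b c with h | h
      · exact .inl (Exec.weaken (Exec.loop_true rfl (.pop_a _ _ _ _ _) h) (by simp; omega))
      · cases h

theorem exec_clear (r : Option Symbol) (d a b c : List Symbol) :
    Exec clear (st r d a b c) (st none d [] b c) (2 * a.length + 2) := by
  rcases a with _ | ⟨x, a⟩
  · exact Exec.weaken (Exec.seq (.pop_a _ _ _ _ _) (.loop_false rfl)) le_rfl
  · rcases exec_clearLoop a (some x) d b c with h | h
    · exact Exec.weaken (Exec.seq (.pop_a _ _ _ _ _) h) (by simp; omega)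
    · cases h

/-- Remove the tree on top of the stack `d`. -/
def drop : Cmd := .seq scan clear

theorem exec_drop (x : Data) (r : Option Symbol) (d : List Symbol) :
    Exec drop (st r (x.ser ++ d) [] [] []) (st none d [] [] []) (9 * x.size + 5) :=
  Exec.weaken (Exec.seq (exec_scan x r d [] []) (exec_clear _ _ _ _ _)) (by simp; omega)

/-- Move the stack `a` onto both of the stacks `d` and `b`. -/
def pourTwice : Cmd :=
  .seq (.pop .a) (.loop Option.isSome
    (.seq (.push .d regSymbol) (.seq (.push .b regSymbol) (.pop .a))))

theorem exec_pourTwice (r : Option Symbol) (d a b c : List Symbol) :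
    Exec pourTwice (st r d a b c) (st none (a.reverse ++ d) [] (a.reverse ++ b) c)
      (4 * a.length + 2) := by
  have key : ∀ (a : List Symbol) (r : Symbol) (d b : List Symbol),
      Exec (.loop Option.isSome (.seq (.push .d regSymbol) (.seq (.push .b regSymbol) (.pop .a))))
        (st (some r) d a b c) (st none (a.reverse ++ r :: d) [] (a.reverse ++ r :: b) c)
        (4 * a.length + 5) := by
    intro a
    induction a with
    | nil =>
      intro r d b
      exact Exec.weaken (Exec.loop_true rfl (.seq (.push_d _ _ _ _ _ _) (.seq (.push_b _ _ _ _ _ _)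
        (.pop_a _ _ _ _ _))) (.loop_false rfl)) (by simp)
    | cons x a ih =>
      intro r d b
      have h := ih x (r :: d) (r :: b)
      refine Exec.weaken (Exec.loop_true rfl (.seq (.push_d _ _ _ _ _ _) (.seq (.push_b _ _ _ _ _ _)
        (.pop_a _ _ _ _ _))) (h.of_eq ?_)) (by simp; omega)
      simp
  rcases a with _ | ⟨x, a⟩
  · exact Exec.weaken (Exec.seq (.pop_a _ _ _ _ _) (.loop_false rfl)) le_rfl
  · refine Exec.weaken (Exec.seq (.pop_a _ _ _ _ _) (Exec.of_eq (key a x d b) ?_)) (by simp; omega)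
    simp

/-- Duplicate the tree on top of the stack `d`. -/
def dup : Cmd := .seq scan <| .seq pourTwice <| .seq (pour .b .a) (pour .a .d)

theorem exec_dup (x : Data) (r : Option Symbol) (d : List Symbol) :
    Exec dup (st r (x.ser ++ d) [] [] []) (st none (x.ser ++ (x.ser ++ d)) [] [] [])
      (17 * x.size + 9) := by
  have h := Exec.seq (exec_scan x r d [] []) <| .seq (exec_pourTwice _ _ _ _ _) <|
    .seq (exec_pour_ba _ _ _ _ _) (exec_pour_ad _ _ _ _ _)
  simp only [List.append_nil, List.reverse_reverse, List.length_reverse, Data.length_ser] at h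
  exact h.weaken (by omega)

/-- Push a word onto the stack `d`. -/
def pushWord : List Symbol → Cmd
  | [] => .pop .a
  | s :: w => .seq (pushWord w) (.push .d fun _ => s)

theorem exec_pushWord (w : List Symbol) (r : Option Symbol) (d b c : List Symbol) :
    Exec (pushWord w) (st r d [] b c) (st none (w ++ d) [] b c) (w.length + 1) := by
  induction w with
  -- Popping the empty stack `a` serves as the empty program; it only clears the register.
  | nil => exact .pop_a _ _ _ _ _
  | cons s w ih => exact .seq ih (.push_d _ _ _ _ _ _)

/-- Truth values as trees. -/
def Data.ofBool (b : Bool) : Data := .atom (.val b)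

/-- Is the tree more than a leaf? -/
def Data.isCons : Data → Bool
  | .atom _ => false
  | .cons _ _ => true

/-! ### Functions on trees that are computed in polynomial time -/

theorem eval_mono (p : Polynomial ℕ) {m n : ℕ} (h : m ≤ n) : p.eval m ≤ p.eval n := by
  rw [Polynomial.eval_eq_sum_range, Polynomial.eval_eq_sum_range]
  exact Finset.sum_le_sum fun i _ => Nat.mul_le_mul_left _ (Nat.pow_le_pow_left h i)

/-- Some program replaces the tree `x i` on top of the stack `d` by `y i`, for every `i`, and both
its running time and the size of `y i` are bounded by a polynomial in the size of `x i`. -/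
def Computes {ι : Type} (x y : ι → Data) : Prop :=
  ∃ (c : Cmd) (p : Polynomial ℕ), ∀ i, (y i).size ≤ p.eval (x i).size ∧
    ∀ r d, ∃ r', Exec c (st r ((x i).ser ++ d) [] [] []) (st r' ((y i).ser ++ d) [] [] [])
      (p.eval (x i).size)

namespace Computes

variable {ι : Type} {x y z : ι → Data}

theorem refl (x : ι → Data) : Computes x x :=
  ⟨.pop .a, Polynomial.X + 1, fun i => ⟨by simp, fun r d => ⟨_, Exec.weaken (Exec.pop_a _ _ _ _ _)
    (by simp)⟩⟩⟩

theorem comap {κ : Type} (f : κ → ι) (h : Computes x y) :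
    Computes (fun k => x (f k)) (fun k => y (f k)) := by
  obtain ⟨c, p, h⟩ := h
  exact ⟨c, p, fun k => h (f k)⟩

/-- The second program runs on an input of size at most `p₁`, which is why sizes of results are
bounded along with times. -/
theorem trans (h₁ : Computes x y) (h₂ : Computes y z) : Computes x z := by
  obtain ⟨c₁, p₁, h₁⟩ := h₁
  obtain ⟨c₂, p₂, h₂⟩ := h₂
  refine ⟨.seq c₁ c₂, p₁ + p₂.comp p₁, fun i => ?_⟩
  have hm := eval_mono p₂ (h₁ i).1
  refine ⟨(h₂ i).1.trans (by simp; omega), fun r d => ?_⟩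
  obtain ⟨r₁, e₁⟩ := (h₁ i).2 r d
  obtain ⟨r₂, e₂⟩ := (h₂ i).2 r₁ d
  exact ⟨r₂, Exec.weaken (e₁.seq e₂) (by simp; omega)⟩

theorem const (x : ι → Data) (y : Data) : Computes x fun _ => y := by
  refine ⟨.seq drop (pushWord y.ser), 9 * Polynomial.X + ((y.size + 6 : ℕ) : Polynomial ℕ), fun i => ?_⟩
  refine ⟨by simp; omega, fun r d => ⟨_, Exec.weaken (Exec.seq (exec_drop _ _ _)
    (exec_pushWord _ _ _ _ _)) ?_⟩⟩
  simp
  omega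

/-- Duplicate the input, turn the upper copy into `z`, swap, and turn the other copy into `y`. Each
program leaves whatever lies below its argument on `d` untouched. -/
theorem cons (hy : Computes x y) (hz : Computes x z) :
    Computes x fun i => .cons (y i) (z i) := by
  obtain ⟨c₁, p₁, h₁⟩ := hy
  obtain ⟨c₂, p₂, h₂⟩ := hz
  refine ⟨.seq dup <| .seq c₂ <| .seq swap <| .seq c₁ (.push .d fun _ => .node),
    17 * Polynomial.X + 17 * p₂ + p₁ + 16 * Polynomial.X + 30, fun i => ?_⟩
  refine ⟨?_, fun r d => ?_⟩
  · have := (h₁ i).1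
    have := (h₂ i).1
    simp
    omega
  · obtain ⟨r₂, e₂⟩ := (h₂ i).2 none ((x i).ser ++ d)
    obtain ⟨r₁, e₁⟩ := (h₁ i).2 none ((z i).ser ++ d)
    have hs := (h₂ i).1
    refine ⟨r₁, ?_⟩
    have e := Exec.seq (exec_dup (x i) r d) <| .seq e₂ <| .seq (exec_swap (z i) (x i) r₂ d) <|
      .seq e₁ (.push_d (fun _ => .node) _ _ _ _ _)
    have hw : (Data.cons (y i) (z i)).ser ++ d = .node :: ((y i).ser ++ ((z i).ser ++ d)) := by
      simp [Data.ser]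
    rw [hw]
    refine e.weaken ?_
    simp
    omega

theorem snd : Computes (fun i => .cons (x i) (y i)) y := by
  refine ⟨.seq (.pop .d) drop, 9 * Polynomial.X + 6, fun i => ⟨by simp; omega, fun r d => ?_⟩⟩
  have hw : (Data.cons (x i) (y i)).ser ++ d = .node :: ((x i).ser ++ ((y i).ser ++ d)) := by
    simp [Data.ser]
  rw [hw]
  exact ⟨_, Exec.weaken (Exec.seq (.pop_d _ _ _ _ _) (exec_drop _ _ _)) (by simp; omega)⟩

theorem fst : Computes (fun i => .cons (x i) (y i)) x := by
  refine ⟨.seq (.pop .d) (.seq swap drop), 25 * Polynomial.X + 20,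
    fun i => ⟨by simp; omega, fun r d => ?_⟩⟩
  have hw : (Data.cons (x i) (y i)).ser ++ d = .node :: ((x i).ser ++ ((y i).ser ++ d)) := by
    simp [Data.ser]
  rw [hw]
  exact ⟨_, Exec.weaken (Exec.seq (.pop_d _ _ _ _ _) (.seq (exec_swap _ _ _ _)
    (exec_drop _ _ _))) (by simp; omega)⟩

theorem atom_eq (s : ι → Symbol) (s₀ : Symbol) :
    Computes (fun i => .atom (s i)) fun i => .ofBool (s i = s₀) := by
  refine ⟨.seq (.pop .d) <| .seq (.pop .d) <| .seq
    (.push .d fun r => .val (r = some s₀)) (.push .d fun _ => .sep),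
    4, fun i => ⟨by simp [Data.ofBool], fun r d => ?_⟩⟩
  refine ⟨_, Exec.weaken (Exec.of_eq (Exec.seq (.pop_d _ _ _ _ _) <| .seq (.pop_d _ _ _ _ _) <|
    .seq (.push_d _ _ _ _ _ _) (.push_d _ _ _ _ _ _)) (s'' := st (some (s i)) _ _ _ _)
    ?_) (by simp)⟩
  simp [Data.ser, Data.ofBool]

/-- The first symbol of the prefix notation decides; it is put back so that the whole tree can be
dropped. -/
theorem isCons : Computes x fun i => .ofBool (x i).isCons := by
  refine ⟨.seq (.pop .d) <| .seq (.push .d regSymbol) <|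
    .ite (fun r => r = some .node)
      (.seq drop (pushWord (Data.ofBool true).ser))
      (.seq drop (pushWord (Data.ofBool false).ser)), 9 * Polynomial.X + 11,
    fun i => ⟨by simp [Data.ofBool], fun r d => ?_⟩⟩
  have ht := exec_pushWord (Data.ofBool true).ser none d [] []
  have hf := exec_pushWord (Data.ofBool false).ser none d [] []
  beta_reduce
  rcases h : x i with s | ⟨y, z⟩
  · exact ⟨_, Exec.weaken (Exec.seq (.pop_d _ _ _ _ _) <| .seq (.push_d _ _ _ _ _ _) <|
      .ite_false rfl (.seq (exec_drop (.atom s) _ _) hf)) (by simp [Data.ofBool])⟩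
  · exact ⟨_, Exec.weaken (Exec.seq (.pop_d _ _ _ _ _) <| .seq (.push_d _ _ _ _ _ _) <|
      .ite_true rfl (.seq (exec_drop (.cons y z) _ _) ht)) (by simp [Data.ofBool]; omega)⟩

/-- The test runs on a duplicate. Since `Computes` speaks of families, each branch only has to be
correct on the indices that take it. -/
theorem cases {p : ι → Bool} (hp : Computes x fun i => .ofBool (p i))
    (h₁ : Computes (fun i : {i // p i = true} => x i) fun i => y i)
    (h₂ : Computes (fun i : {i // p i = false} => x i) fun i => y i) : Computes x y := by
  obtain ⟨c, q, h⟩ := hp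
  obtain ⟨c₁, q₁, h₁⟩ := h₁
  obtain ⟨c₂, q₂, h₂⟩ := h₂
  refine ⟨.seq dup <| .seq c <| .seq (.pop .d) <| .seq (.pop .d) <|
    .ite (fun r => r = some (.val true)) c₁ c₂,
    q + q₁ + q₂ + 17 * Polynomial.X + 12, fun i => ?_⟩
  rcases hi : p i with _ | _
  · refine ⟨((h₂ ⟨i, hi⟩).1).trans (by simp; omega), fun r d => ?_⟩
    obtain ⟨r', e⟩ := (h i).2 none ((x i).ser ++ d)
    obtain ⟨r₂, e₂⟩ := (h₂ ⟨i, hi⟩).2 (some (.val (p i))) d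
    refine ⟨r₂, Exec.weaken (Exec.seq (exec_dup _ _ _) <| .seq e <| .seq (.pop_d _ _ _ _ _) <|
      .seq (.pop_d _ _ _ _ _) (.ite_false ?_ e₂)) ?_⟩
    · simp [hi, Data.ser, Data.ofBool, st]
    · simp; omega
  · refine ⟨((h₁ ⟨i, hi⟩).1).trans (by simp; omega), fun r d => ?_⟩
    obtain ⟨r', e⟩ := (h i).2 none ((x i).ser ++ d)
    obtain ⟨r₂, e₂⟩ := (h₁ ⟨i, hi⟩).2 (some (.val (p i))) d
    refine ⟨r₂, Exec.weaken (Exec.seq (exec_dup _ _ _) <| .seq e <| .seq (.pop_d _ _ _ _ _) <|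
      .seq (.pop_d _ _ _ _ _) (.ite_true ?_ e₂)) ?_⟩
    · simp [hi, Data.ser, Data.ofBool, st]
    · simp; omega

end Computes

/-! ### Typed functions that are computed in polynomial time -/

/-- Types whose elements are written as trees. -/
class Coded (α : Type) : Type where
  code : α → Data

open Coded (code)

instance : Coded Symbol := ⟨Data.atom⟩

instance : Coded Bool := ⟨Data.ofBool⟩

instance {α β : Type} [Coded α] [Coded β] : Coded (α × β) := ⟨fun p => .cons (code p.1) (code p.2)⟩

/-- The tree that writes a list. -/
def codeList {α : Type} [Coded α] : List α → Data
  | [] => .atom .sep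
  | x :: l => .cons (code x) (codeList l)

instance {α : Type} [Coded α] : Coded (List α) := ⟨codeList⟩

/-- The length of the word that writes `x`. -/
def size {α : Type} [Coded α] (x : α) : ℕ := (code x).size

variable {ι κ α β γ σ : Type} [Coded ι] [Coded κ] [Coded α] [Coded β] [Coded γ] [Coded σ]

@[simp] theorem size_symbol (s : Symbol) : size s = 2 := rfl

@[simp] theorem size_bool (b : Bool) : size b = 2 := rfl

@[simp] theorem size_pair (p : α × β) : size p = size p.1 + size p.2 + 1 := Data.size_cons _ _

@[simp] theorem size_nil : size ([] : List α) = 2 := rfl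

@[simp] theorem size_cons (x : α) (l : List α) : size (x :: l) = size x + size l + 1 :=
  Data.size_cons _ _

theorem length_le_size (l : List α) : l.length ≤ size l := by
  induction l with
  | nil => simp
  | cons x l ih => simp; omega

theorem size_le_of_mem {x : α} {l : List α} (h : x ∈ l) : size x ≤ size l := by
  induction l with
  | nil => simp at h
  | cons y l ih =>
    rcases List.mem_cons.1 h with rfl | h
    · simp; omega
    · have := ih h
      simp; omega

/-- The function `f` is computed by a program in polynomial time. -/
@[fun_prop]
def Poly (f : ι → α) : Prop := Computes (fun i => code i) fun i => code (f i)

namespace Poly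

theorem bound {f : ι → α} (hf : Poly f) : ∃ p : Polynomial ℕ, ∀ i, size (f i) ≤ p.eval (size i) := by
  obtain ⟨_, p, h⟩ := hf
  exact ⟨p, fun i => (h i).1⟩

@[fun_prop]
theorem id : Poly fun i : ι => i := Computes.refl _

@[fun_prop]
theorem const (y : α) : Poly fun _ : ι => y := Computes.const _ _

@[fun_prop]
theorem comp {g : κ → α} {f : ι → κ} (hg : Poly g) (hf : Poly f) : Poly fun i => g (f i) :=
  Computes.trans hf (hg.comap f)

@[fun_prop]
theorem pair {f : ι → α} {g : ι → β} (hf : Poly f) (hg : Poly g) : Poly fun i => (f i, g i) :=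
  Computes.cons hf hg

@[fun_prop]
theorem fst {f : ι → α × β} (hf : Poly f) : Poly fun i => (f i).1 :=
  Computes.trans hf Computes.fst

@[fun_prop]
theorem snd {f : ι → α × β} (hf : Poly f) : Poly fun i => (f i).2 :=
  Computes.trans hf Computes.snd

@[fun_prop]
theorem cons {f : ι → α} {g : ι → List α} (hf : Poly f) (hg : Poly g) : Poly fun i => f i :: g i :=
  Computes.cons hf hg

@[fun_prop]
theorem cond {p : ι → Bool} {f g : ι → α} (hp : Poly p) (hf : Poly f) (hg : Poly g) :
    Poly fun i => bif p i then f i else g i := by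
  refine Computes.cases hp ?_ ?_
  · obtain ⟨c, q, h⟩ := hf
    exact ⟨c, q, fun ⟨i, hi⟩ => by simpa [hi] using h i⟩
  · obtain ⟨c, q, h⟩ := hg
    exact ⟨c, q, fun ⟨i, hi⟩ => by simpa [hi] using h i⟩

@[fun_prop]
theorem not {p : ι → Bool} (hp : Poly p) : Poly fun i => !p i := by
  have : (fun i => !p i) = fun i => bif p i then false else true := by
    funext i; cases p i <;> rfl
  rw [this]
  fun_prop

@[fun_prop]
theorem and {p q : ι → Bool} (hp : Poly p) (hq : Poly q) : Poly fun i => p i && q i := by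
  have : (fun i => p i && q i) = fun i => bif p i then q i else false := by
    funext i; cases p i <;> rfl
  rw [this]
  fun_prop

@[fun_prop]
theorem or {p q : ι → Bool} (hp : Poly p) (hq : Poly q) : Poly fun i => p i || q i := by
  have : (fun i => p i || q i) = fun i => bif p i then true else q i := by
    funext i; cases p i <;> rfl
  rw [this]
  fun_prop

/-- A nonempty list is written by the same tree as the pair of its head and tail, so `h` applies to
it unchanged; on the empty list the value is a constant. -/
theorem listCases {f : List α → β} (h : Poly fun p : α × List α => f (p.1 :: p.2)) : Poly f := by
  have hp : Poly fun l : List α => (code l).isCons := Computes.isCons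
  refine Computes.cases hp ?_ ?_
  · obtain ⟨c, p, h⟩ := h
    refine ⟨c, p, fun ⟨l, hl⟩ => ?_⟩
    rcases l with _ | ⟨x, l⟩
    · cases hl
    · exact h (x, l)
  · obtain ⟨c, p, h⟩ := const (ι := List α) (f [])
    refine ⟨c, p, fun ⟨l, hl⟩ => ?_⟩
    rcases l with _ | ⟨x, l⟩
    · exact h []
    · cases hl

@[fun_prop]
theorem headD {l : ι → List α} (hl : Poly l) (x : α) : Poly fun i => (l i).headD x :=
  comp (g := fun l : List α => l.headD x) (listCases (fst id)) hl

@[fun_prop]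
theorem tail {l : ι → List α} (hl : Poly l) : Poly fun i => (l i).tail :=
  comp (g := fun l : List α => l.tail) (listCases (snd id)) hl

@[fun_prop]
theorem isEmpty {l : ι → List α} (hl : Poly l) : Poly fun i => (l i).isEmpty :=
  comp (g := fun l : List α => l.isEmpty) (listCases (const false)) hl

/-! ### Folds -/

/-- Test for a nonempty list on top of the stack `d`, as first component of a pair. -/
def peek : Cmd :=
  .seq (.pop .d) <| .seq (.pop .d) <| .seq (.push .d regSymbol) (.push .d fun _ => .node)

/-- The result of the test of `peek`. -/
def peekResult : List α → Symbol
  | [] => .sep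
  | _ :: _ => .node

theorem exec_peek (l : List α) (y : Data) (r : Option Symbol) (d : List Symbol) :
    Exec peek (st r ((Data.cons (code l) y).ser ++ d) [] [] [])
      (st (some (peekResult l)) ((Data.cons (code l) y).ser ++ d) [] [] []) 4 := by
  rcases l with _ | ⟨x, l⟩ <;>
  exact Exec.weaken (Exec.seq (.pop_d _ _ _ _ _) <| .seq (.pop_d _ _ _ _ _) <|
    .seq (.push_d _ _ _ _ _ _) (.push_d _ _ _ _ _ _)) (by simp)

/-- The stack holds the remaining list, the parameter and the accumulator. As long as accumulators
have size at most `N`, every pass costs at most the same amount; the 5 pays for `peek` and the loop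
test, and the 2 for the pairing nodes. -/
theorem exec_foldLoop {step : ι → σ → α → σ} {c : Cmd} {p : Polynomial ℕ}
    (hc : ∀ q : (α × List α) × ι × σ, ∀ r d, ∃ r', Exec c (st r ((code q).ser ++ d) [] [] [])
      (st r' ((code (q.1.2, q.2.1, step q.2.1 q.2.2 q.1.1)).ser ++ d) [] [] []) (p.eval (size q)))
    (i : ι) (N : ℕ) (l : List α) : ∀ s : σ,
    (∀ l₁, l₁ <+: l → size (l₁.foldl (step i) s) ≤ N) → ∀ d,
    Exec (.loop (fun r => r = some .node) (.seq c peek))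
      (st (some (peekResult l)) ((code (l, i, s)).ser ++ d) [] [] [])
      (st (some .sep) ((code (([] : List α), i, l.foldl (step i) s)).ser ++ d) [] [] [])
      (l.length * (p.eval (size l + size i + N + 2) + 5) + 1) := by
  induction l with
  | nil =>
    intro s _ d
    exact Exec.weaken (Exec.loop_false rfl) (by simp)
  | cons x l ih =>
    intro s hs d
    obtain ⟨r, e⟩ := hc ((x, l), i, s) (some .node) d
    have h := ih (step i s x) (fun l₁ h₁ => hs (x :: l₁) (by simpa using h₁)) d
    refine Exec.weaken (Exec.loop_true rfl (.seq e (exec_peek l _ _ _)) h) ?_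
    have h₁ : p.eval (size ((x, l), i, s)) ≤ p.eval (size (x :: l) + size i + N + 2) := by
      have := hs [] (by simp)
      refine eval_mono _ ?_
      simp at this ⊢
      omega
    have h₂ : p.eval (size l + size i + N + 2) ≤ p.eval (size (x :: l) + size i + N + 2) :=
      eval_mono _ (by simp; omega)
    have h₃ := Nat.mul_le_mul_left l.length (Nat.add_le_add_right h₂ 5)
    simp only [List.length_cons, Nat.succ_mul]
    omega

/-- The hypothesis on all prefixes is essential: iterating a polynomial-time step may make the
accumulator grow exponentially. -/
theorem foldl {init : ι → σ} {l : ι → List α} {step : ι → σ → α → σ} (hi : Poly init)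
    (hl : Poly l) (hs : Poly fun q : ι × σ × α => step q.1 q.2.1 q.2.2)
    (hb : ∃ q : Polynomial ℕ, ∀ i l₁, l₁ <+: l i →
      size (l₁.foldl (step i) (init i)) ≤ q.eval (size i)) :
    Poly fun i => (l i).foldl (step i) (init i) := by
  obtain ⟨q, hq⟩ := hb
  have hbody : Poly fun q : (α × List α) × ι × σ => (q.1.2, q.2.1, step q.2.1 q.2.2 q.1.1) := by
    have : Poly fun q : (α × List α) × ι × σ => step q.2.1 q.2.2 q.1.1 :=
      hs.comp (f := fun q : (α × List α) × ι × σ => (q.2.1, q.2.2, q.1.1)) (by fun_prop)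
    fun_prop
  obtain ⟨c, p, hc⟩ := hbody
  have hloop : Computes (fun i => code (l i, i, init i))
      fun i => code (([] : List α), i, (l i).foldl (step i) (init i)) := by
    refine ⟨.seq peek (.loop (fun r => r = some .node) (.seq c peek)),
      Polynomial.X * (p.comp (Polynomial.X + q) + 5) + Polynomial.X + q + 5, fun i => ?_⟩
    have hS : (code (l i, i, init i)).size = size (l i) + size i + size (init i) + 2 := by
      change size (l i, i, init i) = _
      simp; omega
    have hq' : q.eval (size i) ≤ q.eval (code (l i, i, init i)).size :=
      eval_mono _ (by omega)
    refine ⟨?_, fun r d => ⟨_, Exec.weaken (Exec.seq (exec_peek (l i) _ _ _)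
      (exec_foldLoop (fun q => (hc q).2) i _ (l i) (init i) (hq i) d)) ?_⟩⟩
    · have := hq i _ List.prefix_rfl
      have h2 : size (init i) ≤ (code (l i, i, init i)).size := by omega
      change size (([] : List α), i, (l i).foldl (step i) (init i)) ≤ _
      simp
      omega
    · have h₁ : p.eval (size (l i) + size i + q.eval (size i) + 2) ≤
          p.eval ((code (l i, i, init i)).size + q.eval (code (l i, i, init i)).size) :=
        eval_mono _ (by omega)
      have h₂ : (l i).length ≤ (code (l i, i, init i)).size :=
        (length_le_size _).trans (by omega)
      have := Nat.mul_le_mul h₂ (Nat.add_le_add_right h₁ 5)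
      simp
      omega
  have h₀ : Poly fun i => (l i, i, init i) := by fun_prop
  exact (Computes.trans h₀ hloop).trans (Computes.snd.trans Computes.snd)

/-- If the growth in one step is bounded independently of the accumulator, the total growth is at
most the length of the list times that bound. -/
theorem foldl_of_additive {init : ι → σ} {l : ι → List α} {step : ι → σ → α → σ} (hi : Poly init)
    (hl : Poly l) (hs : Poly fun q : ι × σ × α => step q.1 q.2.1 q.2.2) (r : Polynomial ℕ)
    (hr : ∀ i s x, size (step i s x) ≤ size s + r.eval (size i + size x)) :
    Poly fun i => (l i).foldl (step i) (init i) := by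
  refine foldl hi hl hs ?_
  obtain ⟨p, hp⟩ := hi.bound
  obtain ⟨q, hq⟩ := hl.bound
  refine ⟨p + q * r.comp (Polynomial.X + q), fun i l₁ h₁ => ?_⟩
  have key : ∀ (l₁ : List α) (s : σ), (∀ x ∈ l₁, size x ≤ q.eval (size i)) →
      size (l₁.foldl (step i) s) ≤
        size s + l₁.length * r.eval (size i + q.eval (size i)) := by
    intro l₁
    induction l₁ with
    | nil => simp
    | cons x l₁ ih =>
      intro s h
      have h₁ := ih (step i s x) (fun y hy => h y (by simp [hy]))
      have h₂ := hr i s x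
      have h₃ : r.eval (size i + size x) ≤ r.eval (size i + q.eval (size i)) :=
        eval_mono _ (by have := h x (by simp); omega)
      simp only [List.foldl_cons, List.length_cons, Nat.succ_mul]
      omega
  have h := key l₁ (init i) fun x hx => (size_le_of_mem (h₁.subset hx)).trans (hq i)
  have h₂ : l₁.length ≤ q.eval (size i) :=
    h₁.length_le.trans ((length_le_size _).trans (hq i))
  have h₃ := Nat.mul_le_mul_right (r.eval (size i + q.eval (size i))) h₂
  have := hp i
  simp
  omega

/-- Reverse the first list and put it in front of the second. -/
theorem reverseAppend {f g : ι → List α} (hf : Poly f) (hg : Poly g) :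
    Poly fun i => (f i).reverse ++ g i := by
  have h := foldl_of_additive (step := fun (_ : ι) s x => x :: s) hg hf (by fun_prop)
    (Polynomial.X + 1) (fun i s x => by simp; omega)
  simpa using h

@[fun_prop]
theorem reverse {f : ι → List α} (hf : Poly f) : Poly fun i => (f i).reverse := by
  simpa using reverseAppend hf (const [])

@[fun_prop]
theorem append {f g : ι → List α} (hf : Poly f) (hg : Poly g) : Poly fun i => f i ++ g i := by
  simpa using reverseAppend hf.reverse hg

theorem any {l : ι → List α} {p : ι → α → Bool} (hl : Poly l)
    (hp : Poly fun q : ι × α => p q.1 q.2) : Poly fun i => (l i).any (p i) := by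
  have h := foldl_of_additive (init := fun _ => false) (step := fun (i : ι) s x => s || p i x)
    (const _) hl (or (by fun_prop) (hp.comp (f := fun q : ι × Bool × α => (q.1, q.2.2))
      (by fun_prop))) 0 (fun i s x => by simp)
  have e : ∀ (i : ι) (l : List α) (b : Bool),
      l.foldl (fun s x => s || p i x) b = (b || l.any (p i)) := by
    intro i l
    induction l with
    | nil => simp
    | cons x l ih => intro b; simp [ih, Bool.or_assoc]
  simpa [e] using h

theorem filter {l : ι → List α} {p : ι → α → Bool} (hl : Poly l)
    (hp : Poly fun q : ι × α => p q.1 q.2) : Poly fun i => (l i).filter (p i) := by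
  have h := foldl_of_additive (init := fun _ => [])
    (step := fun (i : ι) s x => bif p i x then x :: s else s)
    (const _) hl (cond (hp.comp (f := fun q : ι × List α × α => (q.1, q.2.2)) (by fun_prop))
      (by fun_prop) (by fun_prop)) (Polynomial.X + 1)
      (fun i s x => by cases p i x <;> simp; omega)
  have e : ∀ (i : ι) (l s : List α),
      l.foldl (fun s x => bif p i x then x :: s else s) s = (l.filter (p i)).reverse ++ s := by
    intro i l
    induction l with
    | nil => simp
    | cons x l ih => intro s; cases hx : p i x <;> simp [ih, hx]
  simpa [e] using h.reverse

/-! ### Equality -/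

/-- Types whose equality is decided by a program in polynomial time. -/
class DecidesEq (α : Type) [Coded α] [DecidableEq α] : Prop where
  decides : Poly fun p : α × α => decide (p.1 = p.2)

@[fun_prop]
theorem eq [DecidableEq α] [DecidesEq α] {f g : ι → α} (hf : Poly f) (hg : Poly g) :
    Poly fun i => decide (f i = g i) :=
  comp DecidesEq.decides (pair hf hg)

instance : DecidesEq Bool := ⟨by
  have : (fun p : Bool × Bool => decide (p.1 = p.2)) =
      fun p => bif p.1 then p.2 else !p.2 := by
    funext ⟨a, b⟩; cases a <;> cases b <;> rfl
  rw [this]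
  fun_prop⟩

instance [DecidableEq α] [DecidableEq β] [DecidesEq α] [DecidesEq β] : DecidesEq (α × β) := ⟨by
  have : (fun p : (α × β) × α × β => decide (p.1 = p.2)) =
      fun p => decide (p.1.1 = p.2.1) && decide (p.1.2 = p.2.2) := by
    funext ⟨⟨a, b⟩, c, d⟩; simp
  rw [this]
  fun_prop⟩

@[fun_prop]
theorem eq_symbol {f : ι → Symbol} (hf : Poly f) (s : Symbol) :
    Poly fun i => decide (f i = s) :=
  Computes.trans hf (Computes.atom_eq _ _)

instance : Inhabited Symbol := ⟨.sep⟩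

-- The alphabet has nine symbols, and comparison with a fixed symbol is a test of the register.
instance : DecidesEq Symbol := ⟨by
  have : (fun p : Symbol × Symbol => decide (p.1 = p.2)) = fun p =>
      decide (p.1 = .bit true) && decide (p.2 = .bit true) ||
      decide (p.1 = .bit false) && decide (p.2 = .bit false) ||
      decide (p.1 = .sep) && decide (p.2 = .sep) ||
      decide (p.1 = .node) && decide (p.2 = .node) ||
      decide (p.1 = .leaf true) && decide (p.2 = .leaf true) ||
      decide (p.1 = .leaf false) && decide (p.2 = .leaf false) ||
      decide (p.1 = .val true) && decide (p.2 = .val true) ||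
      decide (p.1 = .val false) && decide (p.2 = .val false) ||
      decide (p.1 = .noExplanation) && decide (p.2 = .noExplanation) := by
    funext ⟨a, b⟩; revert a b; decide
  rw [this]
  refine or (or (or (or (or (or (or (or ?_ ?_) ?_) ?_) ?_) ?_) ?_) ?_) ?_ <;>
    exact and (eq_symbol (fst id) _) (eq_symbol (snd id) _)⟩

/-- Strip the first elements off two lists, and record whether they were equal. -/
def matchStep [DecidableEq α] (x₀ : α) (s : List α × Bool) (x : α) : List α × Bool :=
  (s.1.tail, s.2 && !s.1.isEmpty && decide (s.1.headD x₀ = x))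

/-- Two lists are equal iff all comparisons succeed and nothing is left over. The default `x₀` never
matters, since the flag falls when the list being stripped is too short. -/
theorem matchStep_foldl {α : Type} [DecidableEq α] (x₀ : α) (l : List α) : ∀ s : List α × Bool,
    ((l.foldl (matchStep x₀) s).2 && (l.foldl (matchStep x₀) s).1.isEmpty) =
      (s.2 && decide (l = s.1)) := by
  induction l with
  | nil => rintro ⟨_ | ⟨y, t⟩, b⟩ <;> simp
  | cons x l ih =>
    intro s
    rw [List.foldl_cons, ih]
    obtain ⟨_ | ⟨y, t⟩, b⟩ := s
    · simp [matchStep]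
    · by_cases h : y = x
      · simp [matchStep, h]
      · simp [matchStep, h, Ne.symm h]

instance [Inhabited α] [DecidableEq α] [DecidesEq α] : DecidesEq (List α) := ⟨by
  have h := foldl_of_additive (ι := List α × List α) (init := fun p => (p.2, true))
    (l := fun p => p.1) (step := fun _ => matchStep default) (by fun_prop) (by fun_prop)
    (by unfold matchStep; fun_prop) 0 (fun i s x => by
      obtain ⟨_ | ⟨y, t⟩, b⟩ := s <;> simp [matchStep]; omega)
  have h' := and (snd h) (isEmpty (fst h))
  simpa [matchStep_foldl] using h'⟩

end Poly

/-! ### From programs on trees to Turing machines on words -/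

/-- Turn the word on the stack `d` into the tree that writes it. -/
def readWord : Cmd :=
  .seq (pour .d .a) <| .seq (.push .d fun _ => .sep) <| .seq (.push .d fun _ => .sep) <|
    .seq (.pop .a) <| .loop Option.isSome <| .seq (.push .d regSymbol) <|
      .seq (.push .d fun _ => .sep) <| .seq (.push .d fun _ => .node) (.pop .a)

theorem exec_readWord (w : List Symbol) :
    Exec readWord (st none w [] [] []) (st none (code w).ser [] [] []) (8 * w.length + 6) := by
  have key : ∀ (u v : List Symbol), Exec (.loop Option.isSome <| .seq (.push .d regSymbol) <|
      .seq (.push .d fun _ => .sep) <| .seq (.push .d fun _ => .node) (.pop .a))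
      (st u.head? (code v).ser u.tail [] []) (st none (code (u.reverse ++ v)).ser [] [] [])
      (5 * u.length + 1) := by
    intro u
    induction u with
    | nil => exact fun v => .weaken (.loop_false rfl) (by simp)
    | cons s u ih =>
      intro v
      refine Exec.weaken (Exec.loop_true rfl (.seq (.push_d _ _ _ _ _ _) <|
        .seq (.push_d _ _ _ _ _ _) <| .seq (.push_d _ _ _ _ _ _) (.pop_a _ _ _ _ _))
        ((ih (s :: v)).of_eq ?_)) (by simp; omega)
      simp
  -- The two separators write the empty list. The word lies reversed on `a`, so that consing its
  -- letters one by one restores the order.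
  have h : Exec _ (st w.reverse.head? [.sep, .sep] w.reverse.tail [] []) _ _ := key w.reverse []
  simp only [List.reverse_reverse, List.append_nil, List.length_reverse] at h
  have e₀ := exec_pour_da none w [] [] []
  rw [List.append_nil] at e₀
  exact Exec.weaken (Exec.seq e₀ <| .seq (.push_d _ _ _ _ _ _) <|
    .seq (.push_d _ _ _ _ _ _) <| .seq (.pop_a _ _ _ _ _) h) (by omega)

/-- Turn the tree on the stack `d` that writes a word into this word. -/
def writeWord : Cmd :=
  .seq (.pop .d) <| .seq (.loop (fun r => r = some .node) <|
    .seq (.pop .d) <| .seq (.pop .d) <| .seq (.push .a regSymbol) (.pop .d)) <|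
    .seq (.pop .d) (pour .a .d)

theorem exec_writeWord (w : List Symbol) (r : Option Symbol) :
    Exec writeWord (st r (code w).ser [] [] []) (st none w [] [] []) (8 * w.length + 5) := by
  have key : ∀ (w a : List Symbol), Exec (.loop (fun r => r = some .node) <|
    .seq (.pop .d) <| .seq (.pop .d) <| .seq (.push .a regSymbol) (.pop .d))
      (st (code w).ser.head? (code w).ser.tail a [] [])
      (st (some .sep) [.sep] (w.reverse ++ a) [] []) (5 * w.length + 1) := by
    intro w
    induction w with
    | nil => exact fun v => .weaken (.loop_false rfl) (by simp)
    | cons s w ih =>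
      intro a
      refine Exec.weaken (Exec.loop_true rfl (.seq (.pop_d _ _ _ _ _) <|
        .seq (.pop_d _ _ _ _ _) <| .seq (.push_a _ _ _ _ _ _) (.pop_d _ _ _ _ _))
        ((ih (s :: a)).of_eq ?_)) (by simp; omega)
      simp
  -- The separator still on `d` after the loop is the second symbol of the empty list; it is
  -- discarded.
  have e := Exec.seq (.pop_d r (code w).ser _ _ _) <| .seq (key w []) <|
    .seq (.pop_d _ _ _ _ _) (exec_pour_ad _ _ _ _ _)
  simp only [List.append_nil, List.reverse_reverse, List.length_reverse, List.tail_cons] at e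
  exact Exec.weaken e (by omega)

/-- Each letter costs a node and a two-symbol atom, so bounds in the size of the tree become bounds
in the length of the word. -/
theorem size_word (w : List Symbol) : size w = 3 * w.length + 2 := by
  induction w with
  | nil => rfl
  | cons s w ih => simp [ih]; omega

theorem Poly.tm2ComputableInPolyTime {I : Type} (encode : I → List Symbol)
    {F : List Symbol → List Symbol} (hF : Poly F) :
    Nonempty (Turing.TM2ComputableInPolyTime encode _root_.id fun i => F (encode i)) := by
  obtain ⟨c, p, h⟩ := hF
  -- The equations for `u` and `v` absorb the maps along the identity that the input and output
  -- alphabets introduce.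
  have key : ∀ w u v : List Symbol, u = w → v = F w →
      Nonempty (Turing.TM2OutputsInTime (Cmd.seq readWord (.seq c writeWord)).machine u
      (some v) ((8 * Polynomial.X + 9 * p.comp (3 * Polynomial.X + 2) + 11 + 1).eval w.length)) := by
    intro w u v hu hv
    rw [hu, hv]
    obtain ⟨r, e⟩ := (h w).2 none []
    simp only [List.append_nil] at e
    have hs := size_word w
    have hF : size (F w) ≤ p.eval (size w) := (h w).1
    have h₀ := size_word (F w)
    have hE := Exec.outputs (Exec.weaken (t' := 8 * w.length + 9 * p.eval (size w) + 11)
      (Exec.seq (exec_readWord w) (.seq e (exec_writeWord (F w) r))) (by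
        change _ + (p.eval (size w) + _) ≤ _
        omega))
    simpa [hs] using hE
  exact ⟨{
    tm := (Cmd.seq readWord (.seq c writeWord)).machine
    inputAlphabet := Equiv.refl _
    outputAlphabet := Equiv.refl _
    time := 8 * Polynomial.X + 9 * p.comp (3 * Polynomial.X + 2) + 11 + 1
    outputsFun := fun i => (key (encode i) _ _ (List.map_id _) (List.map_id _)).some }⟩

end StackProgram

namespace DTExplain

open StackProgram StackProgram.Poly

/-! ### The algorithms on lists of assignments -/

section Algorithms

variable {κ : Type} [DecidableEq κ]

/-- No feature is assigned both values. -/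
def consistent (τ : List (κ × Bool)) : Bool :=
  !(τ.any fun x => τ.any fun y => decide (x.1 = y.1) && !decide (x.2 = y.2))

/-- Given the paths of a decision tree to its leaves, with the classes of the leaves: is a leaf of
class `b` reached by an example that agrees with `τ`? -/
def sat (L : List (List (κ × Bool) × Bool)) (τ : List (κ × Bool)) (b : Bool) : Bool :=
  L.any fun p => decide (p.2 = b) && consistent (p.1 ++ τ)

/-- Remove an assignment. -/
def remove (τ : List (κ × Bool)) (x : κ × Bool) : List (κ × Bool) :=
  τ.filter fun y => !decide (y = x)

/-- Remove an assignment unless this destroys the property `P`. -/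
def greedyStep (P : List (κ × Bool) → Bool) (τ : List (κ × Bool)) (x : κ × Bool) :
    List (κ × Bool) :=
  bif P (remove τ x) then remove τ x else x :: remove τ x

/-- Remove assignments as long as the property `P` is not destroyed. -/
def greedy (P : List (κ × Bool) → Bool) (τ : List (κ × Bool)) : List (κ × Bool) :=
  τ.foldl (greedyStep P) τ

/-- The assignments in `ex` that are not in `A`. -/
def without (ex A : List (κ × Bool)) : List (κ × Bool) :=
  ex.filter fun x => !(A.any fun y => decide (x = y))

/-- The paths to the leaves of class `c` that are not contradictory. -/
def reachable (L : List (List (κ × Bool) × Bool)) (c : Bool) : List (List (κ × Bool) × Bool) :=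
  L.filter fun p => decide (p.2 = c) && consistent p.1

/-- A minimal local abductive explanation for the example `ex`. -/
def localAXp (L : List (List (κ × Bool) × Bool)) (ex : List (κ × Bool)) : List (κ × Bool) :=
  greedy (fun τ => !sat L τ (!sat L ex true)) ex

/-- A minimal local contrastive explanation for the example `ex`, if there is one. -/
def localCXp (L : List (List (κ × Bool) × Bool)) (ex : List (κ × Bool)) : List (κ × Bool) :=
  greedy (fun A => sat L (without ex A) (!sat L ex true)) ex

/-- A minimal global abductive explanation for the class `c`, if there is one. -/
def globalAXp (L : List (List (κ × Bool) × Bool)) (c : Bool) : List (κ × Bool) :=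
  greedy (fun τ => !sat L τ (!c)) ((reachable L c).headD ([], false)).1

/-! ### Equivariance under injective renaming of features -/

variable {κ' : Type} [DecidableEq κ'] {g : κ → κ'}

/-- Features are only tested for equality, which an injective `g` preserves and reflects; the same
holds for every algorithm below. -/
theorem consistent_map (hg : g.Injective) (τ : List (κ × Bool)) :
    consistent (τ.map (Prod.map g id)) = consistent τ := by
  simp [consistent, List.any_map, Function.comp_def, hg.eq_iff]

theorem sat_map (hg : g.Injective) (L : List (List (κ × Bool) × Bool)) (τ : List (κ × Bool))
    (b : Bool) : sat (L.map (Prod.map (List.map (Prod.map g id)) id)) (τ.map (Prod.map g id)) b =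
      sat L τ b := by
  simp [sat, List.any_map, Function.comp_def, ← List.map_append, consistent_map hg]

theorem remove_map (hg : g.Injective) (τ : List (κ × Bool)) (x : κ × Bool) :
    remove (τ.map (Prod.map g id)) (Prod.map g id x) = (remove τ x).map (Prod.map g id) := by
  have hi : (Prod.map g (id : Bool → Bool)).Injective := hg.prodMap Function.injective_id
  simp only [remove, List.filter_map, Function.comp_def, hi.eq_iff]

theorem greedy_map (hg : g.Injective) {P : List (κ × Bool) → Bool} {P' : List (κ' × Bool) → Bool}
    (h : ∀ τ, P' (τ.map (Prod.map g id)) = P τ) (τ : List (κ × Bool)) :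
    greedy P' (τ.map (Prod.map g id)) = (greedy P τ).map (Prod.map g id) := by
  have key : ∀ l τ : List (κ × Bool), (l.map (Prod.map g id)).foldl (greedyStep P')
      (τ.map (Prod.map g id)) = (l.foldl (greedyStep P) τ).map (Prod.map g id) := by
    intro l
    induction l with
    | nil => simp
    | cons x l ih =>
      intro τ
      have : greedyStep P' (τ.map (Prod.map g id)) (Prod.map g id x) =
          (greedyStep P τ x).map (Prod.map g id) := by
        simp only [greedyStep, remove_map hg, h]
        cases P (remove τ x) <;> rfl
      simp only [List.map_cons, List.foldl_cons, this, ih]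
  exact key τ τ

theorem without_map (hg : g.Injective) (ex A : List (κ × Bool)) :
    without (ex.map (Prod.map g id)) (A.map (Prod.map g id)) =
      (without ex A).map (Prod.map g id) := by
  have hi : (Prod.map g (id : Bool → Bool)).Injective := hg.prodMap Function.injective_id
  simp only [without, List.filter_map, Function.comp_def, List.any_map, hi.eq_iff]

theorem reachable_map (hg : g.Injective) (L : List (List (κ × Bool) × Bool)) (c : Bool) :
    reachable (L.map (Prod.map (List.map (Prod.map g id)) id)) c =
      (reachable L c).map (Prod.map (List.map (Prod.map g id)) id) := by
  simp only [reachable, List.filter_map, Function.comp_def, Prod.map_fst, Prod.map_snd, id_eq,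
    consistent_map hg]

theorem localAXp_map (hg : g.Injective) (L : List (List (κ × Bool) × Bool))
    (ex : List (κ × Bool)) :
    localAXp (L.map (Prod.map (List.map (Prod.map g id)) id)) (ex.map (Prod.map g id)) =
      (localAXp L ex).map (Prod.map g id) :=
  greedy_map hg (fun τ => by simp only [sat_map hg]) ex

theorem localCXp_map (hg : g.Injective) (L : List (List (κ × Bool) × Bool))
    (ex : List (κ × Bool)) :
    localCXp (L.map (Prod.map (List.map (Prod.map g id)) id)) (ex.map (Prod.map g id)) =
      (localCXp L ex).map (Prod.map g id) :=
  greedy_map hg (fun τ => by simp only [sat_map hg, without_map hg]) ex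

theorem globalAXp_map (hg : g.Injective) (L : List (List (κ × Bool) × Bool)) (c : Bool) :
    globalAXp (L.map (Prod.map (List.map (Prod.map g id)) id)) c =
      (globalAXp L c).map (Prod.map g id) := by
  have h : ((reachable (L.map (Prod.map (List.map (Prod.map g id)) id)) c).headD ([], false)).1 =
      (((reachable L c).headD ([], false)).1).map (Prod.map g id) := by
    rw [reachable_map hg]
    rcases reachable L c with _ | ⟨p, S⟩ <;> simp
  rw [globalAXp, h]
  exact greedy_map hg (fun τ => by simp only [sat_map hg]) _

end Algorithms

/-! ### The algorithms run in polynomial time -/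

section Poly

variable {ι κ : Type} [Coded ι] [Coded κ] [DecidableEq κ] [DecidesEq κ]

@[fun_prop]
theorem poly_consistent {τ : ι → List (κ × Bool)} (hτ : Poly τ) :
    Poly fun i => consistent (τ i) := by
  unfold consistent
  refine Poly.not (Poly.any hτ (Poly.any (by fun_prop) (by fun_prop)))

@[fun_prop]
theorem poly_sat {L : ι → List (List (κ × Bool) × Bool)} {τ : ι → List (κ × Bool)} {b : ι → Bool}
    (hL : Poly L) (hτ : Poly τ) (hb : Poly b) : Poly fun i => sat (L i) (τ i) (b i) := by
  unfold sat
  exact Poly.any hL (by fun_prop)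

@[fun_prop]
theorem poly_remove {τ : ι → List (κ × Bool)} {x : ι → κ × Bool} (hτ : Poly τ) (hx : Poly x) :
    Poly fun i => remove (τ i) (x i) := by
  unfold remove
  exact Poly.filter hτ (by fun_prop)

@[fun_prop]
theorem poly_without {ex A : ι → List (κ × Bool)} (he : Poly ex) (hA : Poly A) :
    Poly fun i => without (ex i) (A i) := by
  unfold without
  exact Poly.filter he (Poly.not (Poly.any (by fun_prop) (by fun_prop)))

@[fun_prop]
theorem poly_reachable {L : ι → List (List (κ × Bool) × Bool)} {c : ι → Bool} (hL : Poly L)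
    (hc : Poly c) : Poly fun i => reachable (L i) (c i) := by
  unfold reachable
  exact Poly.filter hL (by fun_prop)

theorem size_filter_le {α : Type} [Coded α] (l : List α) (p : α → Bool) :
    size (l.filter p) ≤ size l := by
  induction l with
  | nil => simp
  | cons x l ih => cases h : p x <;> simp [h] <;> omega

/-- Removal never enlarges the accumulator, and a failed removal puts back only `x`, so growth is
additive. -/
theorem poly_greedy {P : ι → List (κ × Bool) → Bool} {τ : ι → List (κ × Bool)} (hτ : Poly τ)
    (hP : Poly fun q : ι × List (κ × Bool) => P q.1 q.2) :
    Poly fun i => greedy (P i) (τ i) := by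
  unfold greedy
  refine Poly.foldl_of_additive (step := fun i => greedyStep (P i)) hτ hτ ?_
    (Polynomial.X + 1) ?_
  · unfold greedyStep
    exact Poly.cond (Poly.comp (f := fun q : ι × List (κ × Bool) × κ × Bool =>
      (q.1, remove q.2.1 q.2.2)) hP (by fun_prop)) (by fun_prop) (by fun_prop)
  · intro i s x
    have := size_filter_le s fun y => !decide (y = x)
    unfold greedyStep remove
    generalize P i _ = b
    cases b <;> simp at this ⊢ <;> omega

theorem poly_localAXp {L : ι → List (List (κ × Bool) × Bool)} {ex : ι → List (κ × Bool)}
    (hL : Poly L) (he : Poly ex) : Poly fun i => localAXp (L i) (ex i) := by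
  unfold localAXp
  exact poly_greedy (P := fun i τ => !sat (L i) τ (!sat (L i) (ex i) true)) he (by fun_prop)

theorem poly_localCXp {L : ι → List (List (κ × Bool) × Bool)} {ex : ι → List (κ × Bool)}
    (hL : Poly L) (he : Poly ex) : Poly fun i => localCXp (L i) (ex i) := by
  unfold localCXp
  exact poly_greedy (P := fun i A => sat (L i) (without (ex i) A) (!sat (L i) (ex i) true)) he
    (by fun_prop)

theorem poly_globalAXp {L : ι → List (List (κ × Bool) × Bool)} {c : ι → Bool}
    (hL : Poly L) (hc : Poly c) : Poly fun i => globalAXp (L i) (c i) := by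
  unfold globalAXp
  exact poly_greedy (P := fun i τ => !sat (L i) τ (!c i)) (by fun_prop) (by fun_prop)

end Poly

/-! ### Reading instances and writing solutions -/

/-- Features as they are written. -/
abbrev Word : Type := List Symbol

/-- The word of a solution that lists the assigned features. -/
def featuresWord (l : List (Word × Bool)) : Word :=
  (l.foldl (fun acc x => Symbol.sep :: (x.1.reverse ++ acc)) []).reverse

/-- The word of a solution that lists the assignments. -/
def assignmentsWord (l : List (Word × Bool)) : Word :=
  (l.foldl (fun acc x => Symbol.val x.2 :: Symbol.sep :: (x.1.reverse ++ acc)) []).reverse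

theorem featuresWord_eq (l : List (Word × Bool)) :
    featuresWord l = l.flatMap fun x => x.1 ++ [Symbol.sep] := by
  have key : ∀ (l : List (Word × Bool)) (acc : Word),
      (l.foldl (fun acc x => Symbol.sep :: (x.1.reverse ++ acc)) acc).reverse =
        acc.reverse ++ l.flatMap fun x => x.1 ++ [Symbol.sep] := by
    intro l
    induction l with
    | nil => simp
    | cons x l ih => intro acc; simp [ih]
  exact (key l []).trans (by simp)

theorem assignmentsWord_eq (l : List (Word × Bool)) :
    assignmentsWord l = l.flatMap fun x => x.1 ++ [Symbol.sep] ++ [Symbol.val x.2] := by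
  have key : ∀ (l : List (Word × Bool)) (acc : Word),
      (l.foldl (fun acc x => Symbol.val x.2 :: Symbol.sep :: (x.1.reverse ++ acc)) acc).reverse =
        acc.reverse ++ l.flatMap fun x => x.1 ++ [Symbol.sep] ++ [Symbol.val x.2] := by
    intro l
    induction l with
    | nil => simp
    | cons x l ih => intro acc; simp [ih]
  exact (key l []).trans (by simp)

section

variable {ι : Type} [Coded ι]

@[fun_prop]
theorem poly_val {b : ι → Bool} (hb : Poly b) : Poly fun i => Symbol.val (b i) := by
  have : (fun i => Symbol.val (b i)) = fun i => bif b i then .val true else .val false := by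
    funext i; cases b i <;> rfl
  rw [this]
  fun_prop

theorem size_append {α : Type} [Coded α] (l l' : List α) :
    size (l ++ l') + 2 = size l + size l' := by
  induction l with
  | nil => simp; omega
  | cons x l ih => simp; omega

theorem size_reverse {α : Type} [Coded α] (l : List α) : size l.reverse = size l := by
  induction l with
  | nil => rfl
  | cons x l ih =>
    have := size_append l.reverse [x]
    simp at this ⊢
    omega

theorem poly_featuresWord {l : ι → List (Word × Bool)} (hl : Poly l) :
    Poly fun i => featuresWord (l i) := by
  refine Poly.reverse (Poly.foldl_of_additive
    (step := fun (_ : ι) acc x => Symbol.sep :: (x.1.reverse ++ acc)) (StackProgram.Poly.const _) hl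
    (by fun_prop) (Polynomial.X + 3) fun i s x => ?_)
  have h₁ := size_append x.1.reverse s
  have h₂ := size_reverse x.1
  simp
  omega

theorem poly_assignmentsWord {l : ι → List (Word × Bool)} (hl : Poly l) :
    Poly fun i => assignmentsWord (l i) := by
  refine Poly.reverse (Poly.foldl_of_additive (step := fun (_ : ι) acc x =>
    Symbol.val x.2 :: Symbol.sep :: (x.1.reverse ++ acc)) (StackProgram.Poly.const _) hl
    (by fun_prop) (Polynomial.X + 6) fun i s x => ?_)
  have h₁ := size_append x.1.reverse s
  have h₂ := size_reverse x.1
  simp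
  omega

end

/-- The state of the reader of instances: the bits read last, in reverse order, the number read
last, whether a number has to be read as the label of a node; the path to the node that is read, the
paths to the other nodes that remain to be read; the paths to the leaves that have been read; the
assignments that have been read. -/
abbrev ReaderState : Type :=
  (Word × Word × Bool) × (List (Word × Bool) × List (List (Word × Bool))) ×
    List (List (Word × Bool) × Bool) × List (Word × Bool)

/-- The reader at the end of a number. -/
def readSep (s : ReaderState) : ReaderState :=
  (([], s.1.1.reverse, false),
    (bif s.1.2.2 then ((s.1.1.reverse, false) :: s.2.1.1,
      ((s.1.1.reverse, true) :: s.2.1.1) :: s.2.1.2) else s.2.1), s.2.2)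

/-- The reader at a leaf. -/
def readLeaf (c : Bool) (s : ReaderState) : ReaderState :=
  (s.1, (s.2.1.2.headD [], s.2.1.2.tail), (s.2.1.1, c) :: s.2.2.1, s.2.2.2)

/-- The reader at a value. -/
def readVal (b : Bool) (s : ReaderState) : ReaderState :=
  (s.1, s.2.1, s.2.2.1, (s.1.2.1, b) :: s.2.2.2)

/-- The reader at any symbol. -/
def readStep (s : ReaderState) (x : Symbol) : ReaderState :=
  bif decide (x = .sep) then readSep s else
  bif decide (x = .node) then ((s.1.1, s.1.2.1, true), s.2) else
  bif decide (x = .leaf false) then readLeaf false s else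
  bif decide (x = .leaf true) then readLeaf true s else
  bif decide (x = .val false) then readVal false s else
  bif decide (x = .val true) then readVal true s else
  ((x :: s.1.1, s.1.2), s.2)

/-- The state of the reader after reading a word. -/
def readInstance (w : Word) : ReaderState :=
  w.foldl readStep (([], [], false), ([], []), [], [])

/-- Bounds for the state of the reader after `m` symbols of a word with at most `N` symbols. -/
structure ReaderBound (N m : ℕ) (s : ReaderState) : Prop where
  bits : size s.1.1 ≤ 3 * m + 2
  num : size s.1.2.1 ≤ 3 * N + 2
  path : size s.2.1.1 ≤ m * (3 * N + 6) + 2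
  mem : ∀ p ∈ s.2.1.2, size p ≤ m * (3 * N + 6) + 2
  paths : size s.2.1.2 ≤ m * (N * (3 * N + 6) + 3) + 2
  leaves : size s.2.2.1 ≤ m * (N * (3 * N + 6) + 6) + 2
  assignments : size s.2.2.2 ≤ m * (3 * N + 6) + 2

/-- A number of at most `N` bits has size at most `3 * N + 2`; as an assignment consed to a path it
adds `3 * N + 6`. A path thus has size at most `N * (3 * N + 6) + 2`; consing it to the pending
paths costs 1 more, and together with a class to the leaves 4 more. The bound on every pending path
is needed because a leaf makes one of them current. -/
theorem ReaderBound.step {N m : ℕ} {s : ReaderState} (h : ReaderBound N m s) (hm : m + 1 ≤ N)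
    (x : Symbol) : ReaderBound N (m + 1) (readStep s x) := by
  obtain ⟨⟨bits, num, flag⟩, ⟨path, paths⟩, leaves, assignments⟩ := s
  obtain ⟨h₁, h₂, h₃, h₄, h₅, h₆, h₇⟩ := h
  simp only at h₁ h₂ h₃ h₄ h₅ h₆ h₇
  have hN : (m + 1) * (3 * N + 6) ≤ N * (3 * N + 6) := Nat.mul_le_mul_right _ hm
  have hr := size_reverse bits
  have hmem : ∀ p ∈ paths, size p ≤ (m + 1) * (3 * N + 6) + 2 := fun p hp => by
    have := h₄ p hp
    rw [Nat.succ_mul m]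
    omega
  have htail : size paths.tail ≤ size paths := by
    rcases paths with _ | ⟨p, l⟩ <;> simp
    omega
  have hhead : size (paths.headD []) ≤ (m + 1) * (3 * N + 6) + 2 := by
    rcases paths with _ | ⟨p, l⟩
    · simp
    · exact hmem p (by simp)
  generalize hB : N * (3 * N + 6) = B at *
  have e₁ : (m + 1) * (3 * N + 6) = m * (3 * N + 6) + (3 * N + 6) := by ring
  have e₂ : (m + 1) * (B + 3) = m * (B + 3) + (B + 3) := by ring
  have e₃ : (m + 1) * (B + 6) = m * (B + 6) + (B + 6) := by ring
  have hsep : ReaderBound N (m + 1) (readSep ((bits, num, flag), (path, paths), leaves,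
      assignments)) := by
    cases flag
    · constructor <;> simp [readSep, hB] <;> first | exact hmem | omega
    · constructor <;> simp [readSep, hB] <;>
        first | exact ⟨by omega, fun p hp => by have := hmem p hp; omega⟩ | omega
  have hnode : ReaderBound N (m + 1) ((bits, num, true), (path, paths), leaves, assignments) := by
    constructor <;> simp [hB] <;> first | exact hmem | omega
  have hleaf : ∀ c, ReaderBound N (m + 1) (readLeaf c ((bits, num, flag), (path, paths), leaves,
      assignments)) := by
    intro c
    constructor <;> simp only [readLeaf, hB, size_cons, size_pair, size_bool] <;>
      first | exact fun p hp => hmem p (List.mem_of_mem_tail hp) | omega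
  have hval : ∀ c, ReaderBound N (m + 1) (readVal c ((bits, num, flag), (path, paths), leaves,
      assignments)) := by
    intro c
    constructor <;> simp [readVal, hB] <;> first | exact hmem | omega
  have hbit : ReaderBound N (m + 1) ((x :: bits, num, flag), (path, paths), leaves,
      assignments) := by
    constructor <;> simp [hB] <;> first | exact hmem | omega
  cases x with
  | bit b => exact hbit
  | sep => exact hsep
  | node => exact hnode
  | leaf c => cases c <;> exact hleaf _
  | val b => cases b <;> exact hval _
  | noExplanation => exact hbit

theorem ReaderBound.foldl {N : ℕ} (w : Word) : ∀ {m : ℕ} {s : ReaderState}, ReaderBound N m s →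
    m + w.length ≤ N → ReaderBound N (m + w.length) (w.foldl readStep s) := by
  induction w with
  | nil => exact fun h _ => h
  | cons x w ih =>
    intro m s h hm
    simp only [List.length_cons] at hm ⊢
    have := ih (h.step (by omega) x) (by omega)
    rwa [show m + 1 + w.length = m + (w.length + 1) by omega] at this

-- A step may copy the current path or number, so its growth is not bounded by the symbol read
-- alone; the bounds for the components of the state take the place of additivity.
@[fun_prop]
theorem poly_readInstance : Poly readInstance := by
  refine Poly.foldl (ι := Word) (init := fun _ => (([], [], false), ([], []), [], []))
    (l := fun w => w) (step := fun _ => readStep) (StackProgram.Poly.const _) StackProgram.Poly.id ?_ ?_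
  · unfold readStep readSep readLeaf readVal
    fun_prop
  · refine ⟨Polynomial.X * (Polynomial.X * (3 * Polynomial.X + 6) + 6) * 2 +
      Polynomial.X * (3 * Polynomial.X + 6) * 2 + 6 * Polynomial.X + 30, fun w v hv => ?_⟩
    have hv' : v.length ≤ size w := hv.length_le.trans (length_le_size w)
    have h := ReaderBound.foldl (N := size w) v (m := 0)
      (s := (([], [], false), ([], []), [], []))
      (by constructor <;> simp) (by omega)
    generalize v.foldl readStep _ = s at h
    obtain ⟨h₁, h₂, h₃, h₄, h₅, h₆, h₇⟩ := h
    rw [Nat.zero_add] at *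
    have k₁ := Nat.mul_le_mul_right (3 * size w + 6) hv'
    have k₂ := Nat.mul_le_mul_right (size w * (3 * size w + 6) + 6) hv'
    have k₃ := Nat.mul_le_mul_right (size w * (3 * size w + 6) + 3) hv'
    have k₄ : size w * (size w * (3 * size w + 6) + 3) ≤
      size w * (size w * (3 * size w + 6) + 6) := Nat.mul_le_mul_left _ (by omega)
    simp
    omega

/-! ### Reading an instance -/

/-- The word of a feature. -/
def featureWord {n : ℕ} (f : Fin n) : Word := (Computability.encodeNat f).map Symbol.bit

theorem featureWord_injective {n : ℕ} : (featureWord : Fin n → Word).Injective := by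
  intro f f' h
  have h₁ := (List.map_injective_iff.2 fun b b' h => Symbol.bit.inj h) h
  have h₂ := congrArg Computability.decodeNat h₁
  simpa [Computability.decode_encodeNat, Fin.val_inj] using h₂

/-- The paths of a decision tree to its leaves, in front of the path `τ`, and the classes of the
leaves. -/
def leafPaths {F : Type} (τ : List (F × Bool)) : DecisionTree F → List (List (F × Bool) × Bool)
  | .leaf c => [(τ, c)]
  | .node f t₀ t₁ => leafPaths ((f, false) :: τ) t₀ ++ leafPaths ((f, true) :: τ) t₁

theorem readStep_bit (s : ReaderState) (b : Bool) :
    readStep s (.bit b) = ((.bit b :: s.1.1, s.1.2), s.2) := rfl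

theorem readStep_sep (s : ReaderState) : readStep s .sep = readSep s := rfl

theorem readStep_node (s : ReaderState) :
    readStep s .node = ((s.1.1, s.1.2.1, true), s.2) := rfl

theorem readStep_leaf (s : ReaderState) (c : Bool) : readStep s (.leaf c) = readLeaf c s := by
  cases c <;> rfl

theorem readStep_val (s : ReaderState) (b : Bool) : readStep s (.val b) = readVal b s := by
  cases b <;> rfl

theorem foldl_readStep_number (k : ℕ) (num : Word) (flag : Bool) (p) :
    (encodeNumber k).foldl readStep (([], num, flag), p) =
      readSep ((((Computability.encodeNat k).map Symbol.bit).reverse, num, flag), p) := by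
  have key : ∀ (l : List Bool) (bits : Word), (l.map Symbol.bit).foldl readStep
      ((bits, num, flag), p) = (((l.map Symbol.bit).reverse ++ bits, num, flag), p) := by
    intro l
    induction l with
    | nil => simp
    | cons b l ih => intro bits; simp [readStep_bit, ih]
  simp [encodeNumber, key, readStep_sep]

/-- The reader is a depth-first traversal with an explicit stack: the label of a node extends the
current path towards the 0-child and stacks the path to the 1-child, and a leaf records the current
path and resumes the top of the stack. The number last read is irrelevant afterwards. -/
theorem foldl_readStep_tree {n : ℕ} (t : DecisionTree (Fin n)) :
    ∀ (num : Word) (τ : List (Fin n × Bool)) (paths leaves assignments), ∃ num' : Word,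
    (encodeTree t).foldl readStep (([], num, false), (τ.map (Prod.map featureWord id), paths),
      leaves, assignments) =
    (([], num', false), (paths.headD [], paths.tail),
      ((leafPaths τ t).map (Prod.map (List.map (Prod.map featureWord id)) id)).reverse ++ leaves,
      assignments) := by
  induction t with
  | leaf c =>
    intro num τ paths leaves assignments
    exact ⟨num, by simp [encodeTree, readStep_leaf, readLeaf, leafPaths]⟩
  | node f t₀ t₁ ih₀ ih₁ =>
    intro num τ paths leaves assignments
    obtain ⟨num₀, h₀⟩ := ih₀ (featureWord f) ((f, false) :: τ)
      (((f, true) :: τ).map (Prod.map featureWord id) :: paths) leaves assignments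
    obtain ⟨num₁, h₁⟩ := ih₁ num₀ ((f, true) :: τ) paths _ assignments
    refine ⟨num₁, ?_⟩
    simp only [encodeTree, List.foldl_cons, List.foldl_append, readStep_node,
      foldl_readStep_number, readSep, List.reverse_reverse, cond_true, leafPaths, List.map_append,
      List.reverse_append, List.append_assoc]
    rw [← h₁]
    refine congrArg (fun s => (encodeTree t₁).foldl readStep s) ?_
    exact h₀

theorem foldl_readStep_assignments {n : ℕ} (l : List (Fin n × Bool)) :
    ∀ (num : Word) (p leaves assignments), ∃ num' : Word,
    (encodeAssignments l).foldl readStep (([], num, false), p, leaves, assignments) =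
    (([], num', false), p, leaves, (l.map (Prod.map featureWord id)).reverse ++ assignments) := by
  induction l with
  | nil => exact fun num _ _ _ => ⟨num, rfl⟩
  | cons x l ih =>
    intro num p leaves assignments
    obtain ⟨num', h⟩ := ih (featureWord x.1) p leaves ((featureWord x.1, x.2) :: assignments)
    refine ⟨num', ?_⟩
    simp only [encodeAssignments, List.flatMap_cons, List.foldl_append, foldl_readStep_number,
      readSep, List.foldl_cons, List.foldl_nil, readStep_val, readVal, List.reverse_reverse,
      cond_false] at h ⊢
    rw [List.map_cons, List.reverse_cons, List.append_assoc]
    exact h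

/-- The paths of a decision tree to its leaves, and the classes of the leaves. -/
def DecisionTree.paths {F : Type} (t : DecisionTree F) : List (List (F × Bool) × Bool) :=
  (leafPaths [] t).reverse

/-- The assignments of an example. -/
def assignments {n : ℕ} (e : Example (Fin n)) : List (Fin n × Bool) :=
  ((List.finRange n).map fun f => (f, e f)).reverse

theorem readInstance_tree {n : ℕ} (t : DecisionTree (Fin n)) : ∃ (num : Word) (p : List (Word × Bool) × List (List (Word × Bool))),
    readInstance (encodeNumber n ++ encodeTree t) = (([], num, false), p,
      t.paths.map (Prod.map (List.map (Prod.map featureWord id)) id), []) := by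
  obtain ⟨num, h⟩ := foldl_readStep_tree t ((Computability.encodeNat n).map Symbol.bit) [] [] [] []
  refine ⟨num, ([], []), ?_⟩
  rw [readInstance, List.foldl_append, foldl_readStep_number]
  simp only [readSep, List.reverse_reverse, cond_false]
  refine h.trans ?_
  simp [DecisionTree.paths]

theorem readInstance_local (i : LocalInstance) : ∃ num p, readInstance i.encode = (num, p,
    i.tree.paths.map (Prod.map (List.map (Prod.map featureWord id)) id),
    (assignments i.ex).map (Prod.map featureWord id)) := by
  obtain ⟨num, p, h⟩ := readInstance_tree i.tree
  obtain ⟨num', h'⟩ := foldl_readStep_assignments ((List.finRange i.n).map fun f => (f, i.ex f))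
    num p (i.tree.paths.map (Prod.map (List.map (Prod.map featureWord id)) id)) []
  refine ⟨([], num', false), p, ?_⟩
  rw [LocalInstance.encode, readInstance, List.foldl_append]
  rw [readInstance] at h
  rw [h, h', assignments, List.map_reverse, List.append_nil]

/-- The class is read as an assignment to whatever number came last; `k` carries no information. -/
theorem readInstance_global (i : GlobalInstance) : ∃ num p k, readInstance i.encode = (num, p,
    i.tree.paths.map (Prod.map (List.map (Prod.map featureWord id)) id), [(k, i.c)]) := by
  obtain ⟨num, p, h⟩ := readInstance_tree i.tree
  refine ⟨([], num, false), p, num, ?_⟩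
  rw [GlobalInstance.encode, readInstance, List.foldl_append]
  rw [readInstance] at h
  rw [h, List.foldl_cons, List.foldl_nil, readStep_val, readVal]

/-! ### Correctness of the algorithms -/

section Correctness

variable {F : Type} [DecidableEq F]

/-- The example `e` makes all assignments in the list `τ`. -/
def Satisfies (e : Example F) (τ : List (F × Bool)) : Prop := ∀ x ∈ τ, e x.1 = x.2

theorem consistent_iff (τ : List (F × Bool)) : consistent τ = true ↔ ∃ e, Satisfies e τ := by
  have h₀ : consistent τ = true ↔ ∀ x ∈ τ, ∀ y ∈ τ, x.1 = y.1 → x.2 = y.2 := by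
    simp [consistent]
  rw [h₀]
  constructor
  · intro h
    -- Features not assigned 1 receive 0; consistency is what makes this right for those assigned 0.
    refine ⟨fun f => decide ((f, true) ∈ τ), ?_⟩
    rintro ⟨f, b⟩ hx
    cases b
    · have : (f, true) ∉ τ := fun hy => by simpa using h _ hx _ hy rfl
      simpa using this
    · simpa using hx
  · rintro ⟨e, he⟩ x hx y hy hxy
    rw [← he x hx, ← he y hy, hxy]

theorem satisfies_append {F : Type} {e : Example F} {τ τ' : List (F × Bool)} :
    Satisfies e (τ ++ τ') ↔ Satisfies e τ ∧ Satisfies e τ' := List.forall_mem_append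

/-- At a node, `e` can satisfy only the extension of `τ` that it follows. Contradictory paths, due
to repeated features, are satisfied by no example and do no harm. -/
theorem exists_leafPaths {F : Type} (t : DecisionTree F) (e : Example F) (b : Bool) :
    ∀ τ, (∃ p ∈ leafPaths τ t, p.2 = b ∧ Satisfies e p.1) ↔ Satisfies e τ ∧ t.classify e = b := by
  induction t with
  | leaf c =>
    intro τ
    simp [leafPaths, DecisionTree.classify, and_comm]
  | node f t₀ t₁ ih₀ ih₁ =>
    intro τ
    simp only [leafPaths, List.mem_append, or_and_right, exists_or, ih₀, ih₁,
      DecisionTree.classify]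
    rcases h : e f <;> simp [Satisfies, h]

theorem exists_paths {F : Type} (t : DecisionTree F) (e : Example F) (b : Bool) :
    (∃ p ∈ t.paths, p.2 = b ∧ Satisfies e p.1) ↔ t.classify e = b := by
  simpa [DecisionTree.paths, Satisfies] using exists_leafPaths t e b []

/-- An example that satisfies both `τ` and the path to a leaf of class `b` is the same as one that
satisfies `τ` and has class `b`. -/
theorem sat_iff (t : DecisionTree F) (τ : List (F × Bool)) (b : Bool) :
    sat t.paths τ b = true ↔ ∃ e, Satisfies e τ ∧ t.classify e = b := by
  simp only [sat, List.any_eq_true, Bool.and_eq_true, decide_eq_true_eq, consistent_iff,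
    satisfies_append, ← exists_paths t _ b]
  constructor
  · rintro ⟨p, hp, hb, e, h₁, h₂⟩
    exact ⟨e, h₂, p, hp, hb, h₁⟩
  · rintro ⟨e, h₂, p, hp, hb, h₁⟩
    exact ⟨p, hp, hb, e, h₁, h₂⟩

theorem not_sat_iff (t : DecisionTree F) (τ : List (F × Bool)) (b : Bool) :
    (!sat t.paths τ (!b)) = true ↔ ∀ e, Satisfies e τ → t.classify e = b := by
  rw [Bool.not_eq_true', ← Bool.not_eq_true, sat_iff]
  simp

theorem mem_remove {τ : List (F × Bool)} {x y : F × Bool} :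
    y ∈ remove τ x ↔ y ∈ τ ∧ y ≠ x := by
  simp [remove]

/-- One pass suffices: if `x` could not be removed when it was tried, it cannot be removed from the
smaller final list either, by monotonicity. -/
theorem greedy_spec {P : List (F × Bool) → Bool}
    (hP : ∀ τ τ', τ ⊆ τ' → P τ = true → P τ' = true) {τ : List (F × Bool)} (h : P τ = true) :
    greedy P τ ⊆ τ ∧ P (greedy P τ) = true ∧ (greedy P τ).Nodup ∧
      ∀ x ∈ greedy P τ, P (remove (greedy P τ) x) = false := by
  have key : ∀ l τ : List (F × Bool), P τ = true →
      l.foldl (greedyStep P) τ ⊆ τ ∧ P (l.foldl (greedyStep P) τ) = true ∧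
      -- Removal deletes all copies and a failed removal restores just one, so an element is unique
      -- once it has been tried.
      (∀ x, (x ∈ l ∨ τ.count x ≤ 1) → (l.foldl (greedyStep P) τ).count x ≤ 1) ∧
      ∀ x ∈ l, x ∈ l.foldl (greedyStep P) τ →
        P (remove (l.foldl (greedyStep P) τ) x) = false := by
    intro l
    induction l with
    | nil =>
      intro τ h
      exact ⟨List.Subset.refl _, h, fun x hx => by simpa using hx, by simp⟩
    | cons x l ih =>
      intro τ h
      have hsub : remove τ x ⊆ τ := fun y hy => (mem_remove.1 hy).1
      have hcount : ∀ y, (remove τ x).count y ≤ τ.count y := fun y =>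
        List.filter_sublist.count_le y
      have hx₀ : (remove τ x).count x = 0 :=
        List.count_eq_zero.2 fun hx => (mem_remove.1 hx).2 rfl
      rw [List.foldl_cons]
      rcases hc : P (remove τ x) with _ | _
      · have hs : greedyStep P τ x = x :: remove τ x := by simp [greedyStep, hc]
        by_cases hx : x ∈ τ
        · have hP' : P (x :: remove τ x) = true := hP τ _ (fun y hy => by
            by_cases hyx : y = x
            · simp [hyx]
            · simp [mem_remove, hy, hyx]) h
          obtain ⟨i₁, i₂, i₃, i₄⟩ := ih (x :: remove τ x) hP'
          have i₅ : x :: remove τ x ⊆ τ := List.cons_subset.2 ⟨hx, hsub⟩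
          rw [hs]
          refine ⟨List.Subset.trans i₁ i₅, i₂, fun y hy => i₃ y ?_, fun y hy hy' => ?_⟩
          · by_cases hyx : y = x
            · right; rw [hyx]; simp [hx₀]
            · rcases hy with hy | hy
              · left; simpa [hyx] using hy
              · right
                have := hcount y
                rw [List.count_cons_of_ne (Ne.symm hyx)]
                omega
          · rcases List.mem_cons.1 hy with rfl | hy
            -- The final list without `y` is contained in `remove τ y`, where `P` already failed.
            · rw [← Bool.not_eq_true]
              intro hr
              rw [hP _ (remove τ y) ?_ hr] at hc
              · cases hc
              · intro z hz
                obtain ⟨hz, hzy⟩ := mem_remove.1 hz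
                exact mem_remove.2 ⟨i₅ (i₁ hz), hzy⟩
            · exact i₄ y hy hy'
        -- Removing an element that does not occur loses nothing, so it cannot destroy `P`.
        · exfalso
          rw [hP τ _ (fun y hy => mem_remove.2 ⟨hy, fun e => by rw [e] at hy; exact hx hy⟩) h] at hc
          cases hc
      · have hs : greedyStep P τ x = remove τ x := by simp [greedyStep, hc]
        obtain ⟨i₁, i₂, i₃, i₄⟩ := ih (remove τ x) hc
        rw [hs]
        refine ⟨List.Subset.trans i₁ hsub, i₂, fun y hy => i₃ y ?_, fun y hy hy' => ?_⟩
        · by_cases hyx : y = x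
          · right; rw [hyx]; omega
          · rcases hy with hy | hy
            · left; simpa [hyx] using hy
            · right; exact (hcount y).trans hy
        · rcases List.mem_cons.1 hy with rfl | hy
          · exact absurd rfl (mem_remove.1 (i₁ hy')).2
          · exact i₄ y hy hy'
  obtain ⟨h₁, h₂, h₃, h₄⟩ := key τ τ h
  refine ⟨h₁, h₂, List.nodup_iff_count_le_one.2 fun x => ?_, fun x hx => h₄ x (h₁ hx) hx⟩
  by_cases hx : x ∈ τ
  · exact h₃ x (.inl hx)
  · exact h₃ x (.inr (by rw [List.count_eq_zero.2 hx]; omega))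

end Correctness

/-! ### Local explanations: lists of assignments as sets of features -/

section Local

variable {n : ℕ} (t : DecisionTree (Fin n)) (e : Example (Fin n))

theorem mem_assignments {x : Fin n × Bool} : x ∈ assignments e ↔ e x.1 = x.2 := by
  obtain ⟨f, b⟩ := x
  simp [assignments]

theorem satisfies_assignments {e' : Example (Fin n)} : Satisfies e' (assignments e) ↔ e' = e := by
  constructor
  · intro h
    funext f
    exact h (f, e f) ((mem_assignments e).2 rfl)
  · rintro rfl x hx
    exact (mem_assignments e').1 hx

/-- Only `e` satisfies all its own assignments, so the query evaluates the tree at `e`. -/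
theorem sat_assignments : sat t.paths (assignments e) true = t.classify e := by
  rw [Bool.eq_iff_iff, sat_iff]
  simp [satisfies_assignments]

theorem encodeFeatures_eq (l : List (Fin n)) :
    encodeFeatures l = l.flatMap fun f => encodeNumber f.val := by
  simp [encodeFeatures, List.flatMap_assoc]

/-- The words of a list of assignments that is made by an example list a set of features. -/
theorem writesSet_featuresWord {r : List (Fin n × Bool)} (hr : r ⊆ assignments e) (hd : r.Nodup) :
    WritesSet (featuresWord (r.map (Prod.map featureWord id))) (r.map Prod.fst).toFinset := by
  refine ⟨r.map Prod.fst, ?_, by simp, ?_⟩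
  · refine List.Nodup.map_on ?_ hd
    rintro ⟨f, b⟩ hx ⟨f', b'⟩ hy (rfl : f = f')
    have h₁ := (mem_assignments e).1 (hr hx)
    have h₂ := (mem_assignments e).1 (hr hy)
    simp only at h₁ h₂
    rw [← h₁, ← h₂]
  · rw [featuresWord_eq]
    rw [encodeFeatures_eq, List.flatMap_map, List.flatMap_map]
    rfl

theorem mem_features {r : List (Fin n × Bool)} (hr : r ⊆ assignments e) (f : Fin n) :
    f ∈ (r.map Prod.fst).toFinset ↔ (f, e f) ∈ r := by
  simp only [List.mem_toFinset, List.mem_map, Prod.exists, exists_and_right, exists_eq_right]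
  constructor
  · rintro ⟨b, hb⟩
    have := (mem_assignments e).1 (hr hb)
    simp only at this
    rwa [this]
  · exact fun h => ⟨_, h⟩

/-- A proper subset misses some `f`, so its assignments lie in `r` without `(f, e f)`; by
monotonicity it is enough that no single removal is possible. -/
theorem subsetMinimal_of_remove {P : List (Fin n × Bool) → Bool}
    (hP : ∀ τ τ', τ ⊆ τ' → P τ = true → P τ' = true) {Q : Finset (Fin n) → Prop}
    (hPQ : ∀ r, r ⊆ assignments e → (P r = true ↔ Q (r.map Prod.fst).toFinset))
    {r : List (Fin n × Bool)} (hr : r ⊆ assignments e) (h : P r = true)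
    (h' : ∀ x ∈ r, P (remove r x) = false) : SubsetMinimal Q (r.map Prod.fst).toFinset := by
  refine ⟨(hPQ r hr).1 h, fun A hA hQ => ?_⟩
  refine Finset.Subset.antisymm hA fun f hf => ?_
  by_contra hfA
  have hx := (mem_features e hr f).1 hf
  let s := A.toList.map fun f => (f, e f)
  have hs : s ⊆ assignments e := fun x hx => by
    obtain ⟨f, -, rfl⟩ := List.mem_map.1 hx
    exact (mem_assignments e).2 rfl
  have hsA : (s.map Prod.fst).toFinset = A := by
    ext f
    simp [s]
  have h₁ : P s = true := (hPQ s hs).2 (by rwa [hsA])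
  have h₂ := h' _ hx
  rw [hP s _ ?_ h₁] at h₂
  · cases h₂
  · intro x hxs
    obtain ⟨f', hf', rfl⟩ := List.mem_map.1 hxs
    have hf' : f' ∈ A := by simpa using hf'
    refine mem_remove.2 ⟨(mem_features e hr f').1 (hA hf'), fun heq => ?_⟩
    exact hfA ((Prod.mk.inj heq).1 ▸ hf')

end Local

/-! ### Global explanations: lists of assignments as partial examples -/

section Global

variable {n : ℕ}

/-- The partial example that makes the assignments in a list. -/
def partialExample (r : List (Fin n × Bool)) : PartialExample (Fin n) := fun f =>
  if (f, true) ∈ r then some true else if (f, false) ∈ r then some false else none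

/-- The example `e` witnesses that `r` is free of conflicts, so the preference for 1 in the
definition is harmless. -/
theorem partialExample_eq_some {r : List (Fin n × Bool)} {e : Example (Fin n)}
    (he : Satisfies e r) {f : Fin n} {b : Bool} :
    partialExample r f = some b ↔ (f, b) ∈ r := by
  have h : (f, true) ∈ r → (f, false) ∉ r := fun h₁ h₂ => by
    have h₁ := he _ h₁
    have h₂ := he _ h₂
    simp only at h₁ h₂
    simp [h₁] at h₂
  unfold partialExample
  by_cases h₁ : (f, true) ∈ r
  · cases b <;> simp [h₁, h h₁]
  · by_cases h₂ : (f, false) ∈ r <;> cases b <;> simp [h₁, h₂]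

theorem agrees_partialExample {r : List (Fin n × Bool)} {e e' : Example (Fin n)}
    (he : Satisfies e r) : Agrees e' (partialExample r) ↔ Satisfies e' r := by
  simp only [Agrees, partialExample_eq_some he, Satisfies, Prod.forall]

theorem writesPartialExample_assignmentsWord {r : List (Fin n × Bool)} {e : Example (Fin n)}
    (he : Satisfies e r) (hd : r.Nodup) :
    WritesPartialExample (assignmentsWord (r.map (Prod.map featureWord id)))
      (partialExample r) := by
  refine ⟨r, hd, fun f b => (partialExample_eq_some he).symm, ?_⟩
  rw [assignmentsWord_eq, List.flatMap_map]
  rfl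

/-- A proper restriction is undefined at some `f` to which `r` assigns a value `b`. Every example
satisfying `r` without `(f, b)` agrees with it, so that removal would have succeeded. -/
theorem restrictionMinimal_partialExample (t : DecisionTree (Fin n)) (c : Bool)
    {r : List (Fin n × Bool)} {e : Example (Fin n)} (he : Satisfies e r)
    (h : (!sat t.paths r (!c)) = true)
    (h' : ∀ x ∈ r, (!sat t.paths (remove r x) (!c)) = false) :
    RestrictionMinimal (IsGlobalAXp t.classify c) (partialExample r) := by
  refine ⟨fun e' h₁ => (not_sat_iff t r c).1 h e' ((agrees_partialExample he).1 h₁),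
    fun τ hτ hP => ?_⟩
  by_contra hne
  obtain ⟨f, hf⟩ := Function.ne_iff.1 hne
  have hn : τ f = none := by
    rcases h₁ : τ f with _ | b
    · rfl
    · exact absurd (h₁.trans (hτ f b h₁).symm) hf
  obtain ⟨b, hb⟩ : ∃ b, partialExample r f = some b :=
    Option.ne_none_iff_exists'.1 fun h₁ => hf (hn.trans h₁.symm)
  have hr := (partialExample_eq_some he).1 hb
  have h₂ : (!sat t.paths (remove r (f, b)) (!c)) = true := by
    refine (not_sat_iff t _ c).2 fun e' h₁ => hP e' fun f' b' h₂ => ?_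
    refine h₁ (f', b') (mem_remove.2 ⟨(partialExample_eq_some he).1 (hτ _ _ h₂), fun heq => ?_⟩)
    rw [(Prod.mk.inj heq).1, hn] at h₂
    cases h₂
  rw [h' _ hr] at h₂
  cases h₂

end Global

/-! ### Monotonicity, and the solution of the four problems -/

theorem unsat_mono {F : Type} [DecidableEq F] (t : DecisionTree F) (b : Bool)
    (τ τ' : List (F × Bool)) (h : τ ⊆ τ') (hτ : (!sat t.paths τ b) = true) :
    (!sat t.paths τ' b) = true := by
  rw [← Bool.not_not b, not_sat_iff] at hτ ⊢
  exact fun e he => hτ e fun x hx => he x (h hx)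

theorem mem_without {F : Type} [DecidableEq F] {ex A : List (F × Bool)} {x : F × Bool} :
    x ∈ without ex A ↔ x ∈ ex ∧ x ∉ A := by
  simp only [without, List.mem_filter, Bool.not_eq_true', List.any_eq_false, decide_eq_true_eq]
  exact and_congr_right fun _ => ⟨fun h hx => h x hx rfl, fun h y hy e => h (by rwa [e])⟩

/-- A larger set leaves fewer values of the example fixed, so a counterexample survives. -/
theorem sat_without_mono {F : Type} [DecidableEq F] (t : DecisionTree F) (b : Bool)
    (ex A A' : List (F × Bool)) (h : A ⊆ A') (hA : sat t.paths (without ex A) b = true) :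
    sat t.paths (without ex A') b = true := by
  rw [sat_iff] at hA ⊢
  obtain ⟨e, he, hb⟩ := hA
  refine ⟨e, fun x hx => he x ?_, hb⟩
  rw [mem_without] at hx ⊢
  exact ⟨hx.1, fun h' => hx.2 (h h')⟩

/-- The word that reports that there is no explanation. -/
def reportNone : Word := [Symbol.noExplanation]

/-- The whole example is always an explanation, so greedy deletion can start there and nonexistence
is never reported. -/
theorem dtLocalAXpSubsetMinimal_solvable : dtLocalAXpSubsetMinimal.SolvableInPolyTime := by
  let G : Word → Word := fun w =>
    featuresWord (localAXp (readInstance w).2.2.1 (readInstance w).2.2.2)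
  have hG : Poly G := poly_featuresWord (poly_localAXp (by fun_prop) (by fun_prop))
  refine ⟨fun i => G (LocalInstance.encode i), hG.tm2ComputableInPolyTime _, fun i => .inl ?_⟩
  change LocalInstance at i
  obtain ⟨num, p, h⟩ := readInstance_local i
  have hw : G i.encode =
      featuresWord ((localAXp i.tree.paths (assignments i.ex)).map (Prod.map featureWord id)) := by
    simp only [G, h, localAXp_map featureWord_injective]
  let P : List (Fin i.n × Bool) → Bool := fun τ => !sat i.tree.paths τ (!i.tree.classify i.ex)
  have hP : localAXp i.tree.paths (assignments i.ex) = greedy P (assignments i.ex) := by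
    rw [localAXp, sat_assignments]
  have hmono := unsat_mono i.tree (!i.tree.classify i.ex)
  obtain ⟨h₁, h₂, h₃, h₄⟩ := greedy_spec (P := P) hmono (τ := assignments i.ex)
    ((not_sat_iff _ _ _).2 fun e he => by rw [(satisfies_assignments i.ex).1 he])
  refine ⟨_, subsetMinimal_of_remove i.ex hmono (fun r hr => ?_) h₁ h₂ h₄, ?_⟩
  · refine (not_sat_iff _ _ _).trans ⟨fun H e' he' => (H e' fun x hx => ?_).symm,
      fun H e' he' => (H e' fun f hf => ?_).symm⟩
    · have hx' := (mem_assignments i.ex).1 (hr hx)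
      rw [← hx']
      refine he' x.1 ((mem_features i.ex hr x.1).2 ?_)
      rwa [hx']
    · exact he' _ ((mem_features i.ex hr f).1 hf)
  · have := writesSet_featuresWord i.ex h₁ h₃
    rw [← hP, ← hw] at this
    rw [← hP]
    exact this

/-- Differing from `e` only on a set means satisfying the assignments of `e` outside it. -/
theorem isLocalCXp_iff {n : ℕ} (t : DecisionTree (Fin n)) (e : Example (Fin n))
    {r : List (Fin n × Bool)} (hr : r ⊆ assignments e) :
    sat t.paths (without (assignments e) r) (!t.classify e) = true ↔
      IsLocalCXp t.classify e (r.map Prod.fst).toFinset := by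
  rw [sat_iff]
  refine exists_congr fun e' => and_comm.trans (and_congr (by simp [Bool.eq_not]) ?_)
  constructor
  · intro h f hf
    exact h (f, e f) (mem_without.2 ⟨(mem_assignments e).2 rfl,
      fun h' => hf ((mem_features e hr f).2 h')⟩)
  · intro h x hx
    obtain ⟨h₁, h₂⟩ := mem_without.1 hx
    have hx' := (mem_assignments e).1 h₁
    rw [← hx']
    refine h x.1 fun h' => h₂ ?_
    have := (mem_features e hr x.1).1 h'
    rwa [hx'] at this

/-- Explanations exist iff some example at all has the other class, which is the query with no
assignments. -/
theorem dtLocalCXpSubsetMinimal_solvable : dtLocalCXpSubsetMinimal.SolvableInPolyTime := by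
  let G : Word → Word := fun w =>
    bif sat (readInstance w).2.2.1 [] (!sat (readInstance w).2.2.1 (readInstance w).2.2.2 true) then
      featuresWord (localCXp (readInstance w).2.2.1 (readInstance w).2.2.2) else reportNone
  have hG : Poly G := StackProgram.Poly.cond (by fun_prop)
    (poly_featuresWord (poly_localCXp (by fun_prop) (by fun_prop))) (by fun_prop)
  refine ⟨fun i => G (LocalInstance.encode i), hG.tm2ComputableInPolyTime _, fun i => ?_⟩
  change LocalInstance at i
  obtain ⟨num, p, h⟩ := readInstance_local i
  have hw : G i.encode = bif sat i.tree.paths [] (!i.tree.classify i.ex) then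
      featuresWord ((localCXp i.tree.paths (assignments i.ex)).map (Prod.map featureWord id))
      else reportNone := by
    have h₀ := sat_map featureWord_injective i.tree.paths [] (!i.tree.classify i.ex)
    rw [List.map_nil] at h₀
    simp only [G, h, localCXp_map featureWord_injective, sat_map featureWord_injective,
      sat_assignments, h₀]
  change (∃ s, SubsetMinimal (IsLocalCXp i.tree.classify i.ex) s ∧ WritesSet (G i.encode) s) ∨
    ((∀ s, ¬ SubsetMinimal (IsLocalCXp i.tree.classify i.ex) s) ∧ G i.encode = reportNone)
  rw [hw]
  rcases hs : sat i.tree.paths [] (!i.tree.classify i.ex) with _ | _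
  · right
    refine ⟨fun A hA => ?_, rfl⟩
    obtain ⟨e', he', -⟩ := hA.1
    rw [← Bool.not_eq_true, sat_iff] at hs
    exact hs ⟨e', by simp [Satisfies], Bool.eq_not.2 he'⟩
  · left
    let P : List (Fin i.n × Bool) → Bool := fun A =>
      sat i.tree.paths (without (assignments i.ex) A) (!i.tree.classify i.ex)
    have hP : localCXp i.tree.paths (assignments i.ex) = greedy P (assignments i.ex) := by
      rw [localCXp, sat_assignments]
    have hmono := sat_without_mono i.tree (!i.tree.classify i.ex) (assignments i.ex)
    obtain ⟨h₁, h₂, h₃, h₄⟩ := greedy_spec (P := P) hmono (τ := assignments i.ex) (by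
      -- With all features free nothing stays fixed, so the start of the greedy pass is the
      -- existence test itself.
      have : without (assignments i.ex) (assignments i.ex) = [] :=
        List.eq_nil_iff_forall_not_mem.2 fun x hx => (mem_without.1 hx).2 (mem_without.1 hx).1
      simp only [P, this, hs])
    refine ⟨_, subsetMinimal_of_remove i.ex hmono
      (fun r hr => isLocalCXp_iff i.tree i.ex hr) h₁ h₂ h₄, ?_⟩
    have := writesSet_featuresWord i.ex h₁ h₃
    rw [cond_true, hP]
    exact this

/-- The word of a minimal global abductive explanation for the class `c`. -/
def globalWord (L : List (List (Word × Bool) × Bool)) (c : Bool) : Word :=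
  bif (reachable L c).isEmpty then reportNone else assignmentsWord (globalAXp L c)

@[fun_prop]
theorem poly_globalWord {ι : Type} [Coded ι] {L : ι → List (List (Word × Bool) × Bool)}
    {c : ι → Bool} (hL : Poly L) (hc : Poly c) : Poly fun i => globalWord (L i) (c i) :=
  StackProgram.Poly.cond (by fun_prop) (by fun_prop)
    (poly_assignmentsWord (poly_globalAXp hL hc))

/-- A consistent path to a leaf of class `c` is itself an explanation. Conversely, any explanation
has an agreeing example, and the path that it follows is such a path. -/
theorem globalWord_spec {n : ℕ} (t : DecisionTree (Fin n)) (c : Bool) (w : Word)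
    (hw : w = globalWord (t.paths.map (Prod.map (List.map (Prod.map featureWord id)) id)) c) :
    (∃ s, RestrictionMinimal (IsGlobalAXp t.classify c) s ∧ WritesPartialExample w s) ∨
      ((∀ s, ¬ RestrictionMinimal (IsGlobalAXp t.classify c) s) ∧ w = reportNone) := by
  rw [hw, globalWord, reachable_map featureWord_injective, globalAXp_map featureWord_injective]
  rcases hr : reachable t.paths c with _ | ⟨p, l⟩
  · right
    refine ⟨fun τ hτ => ?_, rfl⟩
    -- Extend `τ` by 0 wherever it is undefined.
    have he : t.classify (fun f => (τ f).getD false) = c :=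
      hτ.1 _ fun f b h => by simp [h]
    obtain ⟨p, hp, hc, hs⟩ := (exists_paths t _ c).2 he
    have : p ∈ reachable t.paths c := by
      simp only [reachable, List.mem_filter, Bool.and_eq_true, decide_eq_true_eq]
      exact ⟨hp, hc, (consistent_iff _).2 ⟨_, hs⟩⟩
    simp [hr] at this
  · left
    have hp : p ∈ reachable t.paths c := by simp [hr]
    simp only [reachable, List.mem_filter, Bool.and_eq_true, decide_eq_true_eq] at hp
    obtain ⟨hp, hc, hcons⟩ := hp
    obtain ⟨e, he⟩ := (consistent_iff _).1 hcons
    let P : List (Fin n × Bool) → Bool := fun τ => !sat t.paths τ (!c)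
    have hP : globalAXp t.paths c = greedy P p.1 := by
      rw [globalAXp, hr]
      rfl
    obtain ⟨h₁, h₂, h₃, h₄⟩ := greedy_spec (P := P) (unsat_mono t (!c)) (τ := p.1)
      ((not_sat_iff _ _ _).2 fun e' he' => (exists_paths t e' c).1 ⟨p, hp, hc, he'⟩)
    have he' : Satisfies e (greedy P p.1) := fun x hx => he x (h₁ hx)
    rw [hP]
    exact ⟨_, restrictionMinimal_partialExample t c he' h₂ h₄,
      writesPartialExample_assignmentsWord he' h₃⟩

theorem dtGlobalAXpSubsetMinimal_solvable : dtGlobalAXpSubsetMinimal.SolvableInPolyTime := by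
  let G : Word → Word := fun w =>
    globalWord (readInstance w).2.2.1 ((readInstance w).2.2.2.headD ([], false)).2
  have hG : Poly G := by fun_prop
  refine ⟨fun i => G (GlobalInstance.encode i), hG.tm2ComputableInPolyTime _, fun i => ?_⟩
  change GlobalInstance at i
  obtain ⟨num, p, k, h⟩ := readInstance_global i
  exact globalWord_spec i.tree i.c _ (by simp only [G, h, List.headD_cons])

theorem isGlobalCXp_eq {F : Type} (M : Model F) (c : Bool) :
    IsGlobalCXp M c = IsGlobalAXp M (!c) := by
  funext τ
  simp only [IsGlobalCXp, IsGlobalAXp, ne_eq, Bool.eq_not]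

theorem dtGlobalCXpSubsetMinimal_solvable : dtGlobalCXpSubsetMinimal.SolvableInPolyTime := by
  let G : Word → Word := fun w =>
    globalWord (readInstance w).2.2.1 (!((readInstance w).2.2.2.headD ([], false)).2)
  have hG : Poly G := by fun_prop
  refine ⟨fun i => G (GlobalInstance.encode i), hG.tm2ComputableInPolyTime _, fun i => ?_⟩
  change GlobalInstance at i
  obtain ⟨num, p, k, h⟩ := readInstance_global i
  have := globalWord_spec i.tree (!i.c) (G i.encode) (by simp only [G, h, List.headD_cons])
  rw [← isGlobalCXp_eq] at this
  exact this

end DTExplain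

theorem mainTheorem6 :
    DTExplain.dtLocalAXpSubsetMinimal.SolvableInPolyTime ∧
    DTExplain.dtLocalCXpSubsetMinimal.SolvableInPolyTime ∧
    DTExplain.dtGlobalAXpSubsetMinimal.SolvableInPolyTime ∧
    DTExplain.dtGlobalCXpSubsetMinimal.SolvableInPolyTime :=
  ⟨DTExplain.dtLocalAXpSubsetMinimal_solvable, DTExplain.dtLocalCXpSubsetMinimal_solvable,
    DTExplain.dtGlobalAXpSubsetMinimal_solvable, DTExplain.dtGlobalCXpSubsetMinimal_solvable⟩
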